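/- Let $k$ be an algebraically closed field. A representation $V$ of the Kronecker quiver $\bullet\rightrightarrows\bullet$ over $k$ (equivalently, a left module over its path algebra $R$) is a pair of $k$-vector spaces $V_1,V_2$ with a pair of linear maps $f_V,g_V\colon V_1\rightrightarrows V_2$. To a point $\lambda\in\mathbb P^1(k)=k\cup\{\infty\}$ assign the map $V_1\to V_2$ equal to $f_V$ if $\lambda=\infty$ and to $g_V-\lambda f_V$ if $\lambda\in k$. For a subset $X\subset\mathbb P^1(k)$, let $\mathcal V_X$ be the class of all representations $V$ whose map at every point $\lambda\in X$ is an isomorphism (for $\infty\in X$ these are the modules over $U_X$, where $R\to U_X=\mathrm{Mat}_2(S_X)$ is the homological ring epimorphism with $S_X=k[x][(x-\lambda)^{-1}:\lambda\in X\setminus\{\infty\}]$). A representation $M$ is called an $X$-comodule if $\mathrm{Hom}_R(M,V)=0=\mathrm{Ext}^1_R(M,V)$ for all $V\in\mathcal V_X$, and a representation $C$ is called an $X$-contramodule if $\mathrm{Hom}_R(V,C)=0=\mathrm{Ext}^1_R(V,C)$ for all $V\in\mathcal V_X$. A $z$-power infinite summation operation on a $k$-vector space $C$ is a $k$-linear map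 $C^{\mathbb N}\to C$, written $(c_n)_{n\ge0}\mapsto\sum_n z^nc_n$, such that $\sum_n z^nc_n=c_0$ whenever $c_n=0$ for all $n\ge1$, and $\sum_i z^i\bigl(\sum_j z^jc_{ij}\bigr)=\sum_n z^n\bigl(\sum_{i+j=n}c_{ij}\bigr)$ for all $(c_{ij})_{i,j\ge0}$; morphisms of such spaces are the linear maps preserving the operations. **Theorem.** Let $X\subset\mathbb P^1(k)$ be any subset with $\infty\in X$. Then: (a) A representation $M$ is an $X$-comodule if and only if it is a direct sum $M=\bigoplus_{\lambda\in X}M_\lambda$ of $\{\lambda\}$-comodules $M_\lambda$. Such a decomposition is functorial (given decompositions of $M$ and $N$, any morphism $M\to N$ is induced by a unique family of morphisms $M_\lambda\to N_\lambda$) and unique (any two decompositions of $M$ are related by a unique family of isomorphisms compatible with the inclusions into $M$). The direct sum functor is an equivalence from the Cartesian product, over $\lambda\in X$, of the categories of $\{\lambda\}$-comodules to the category of $X$-comodules. For each $\lambda\in X$, the category of $\{\lambda\}$-comodules is equivalent to the category of $k$-vector spaces with a locally nilpotent linear operator $z$ (morphisms are the linear maps commuting with $z$). (b) A representation $C$ is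 an $X$-contramodule if and only if it is a direct product $C=\prod_{\lambda\in X}C^\lambda$ of $\{\lambda\}$-contramodules $C^\lambda$. Such a decomposition is functorial (given decompositions of $C$ and $B$, any morphism $C\to B$ is induced by a unique family of morphisms $C^\lambda\to B^\lambda$) and unique (any two decompositions of $C$ are related by a unique family of isomorphisms compatible with the projections from $C$). The direct product functor is an equivalence from the Cartesian product, over $\lambda\in X$, of the categories of $\{\lambda\}$-contramodules to the category of $X$-contramodules. For each $\lambda\in X$, the category of $\{\lambda\}$-contramodules is equivalent to the category of $k$-vector spaces with a $z$-power infinite summation operation. -/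

import Mathlib

open CategoryTheory CategoryTheory.Limits

universe u

namespace KroneckerQuiver

/-- Representations of the Kronecker quiver `• ⇉ •` over `k`, that is, left modules over its path
algebra: functors to `k`-vector spaces from the category with two objects `zero`, `one` and two
parallel arrows `left, right : zero ⟶ one` (and identities). -/
abbrev QuiverRep (k : Type u) [Field k] : Type (u + 1) :=
  WalkingParallelPair ⥤ ModuleCat.{u} k

instance (k : Type u) [Field k] : HasExt.{u + 1} (QuiverRep k) := HasExt.standard _

section Basic

variable {k : Type u} [Field k]

/-- The first map `f_V : V₁ ⟶ V₂` of a representation. -/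
abbrev fMap (V : QuiverRep k) : V.obj .zero ⟶ V.obj .one := V.map .left

/-- The second map `g_V : V₁ ⟶ V₂` of a representation. -/
abbrev gMap (V : QuiverRep k) : V.obj .zero ⟶ V.obj .one := V.map .right

/-- The map `V₁ ⟶ V₂` attached to a point of the projective line `ℙ¹(k) = k ∪ {∞}`:
`f_V` at the point `∞`, and `g_V - c f_V` at a finite point `c`. -/
def mapAt (V : QuiverRep k) : OnePoint k → (V.obj .zero ⟶ V.obj .one)
  | .infty => fMap V
  | .some c => gMap V - c • fMap V

/-- The representations `V` whose maps at all points of `X` are isomorphisms. -/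
def InvertibleOn (X : Set (OnePoint k)) : ObjectProperty (QuiverRep k) :=
  fun V => ∀ p ∈ X, IsIso (mapAt V p)

/-- `M` is an `X`-comodule if `Hom(M, V) = 0 = Ext¹(M, V)` for every representation `V` whose
maps at all points of `X` are isomorphisms. -/
def IsComodule (X : Set (OnePoint k)) : ObjectProperty (QuiverRep k) :=
  fun M => ∀ V : QuiverRep k, InvertibleOn X V →
    (∀ h : M ⟶ V, h = 0) ∧ ∀ e : Abelian.Ext M V 1, e = 0

/-- `C` is an `X`-contramodule if `Hom(V, C) = 0 = Ext¹(V, C)` for every representation `V` whose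
maps at all points of `X` are isomorphisms. -/
def IsContramodule (X : Set (OnePoint k)) : ObjectProperty (QuiverRep k) :=
  fun C => ∀ V : QuiverRep k, InvertibleOn X V →
    (∀ h : V ⟶ C, h = 0) ∧ ∀ e : Abelian.Ext V C 1, e = 0

/-- A decomposition of `M` into a direct sum, indexed by the points `p` of `X`,
of `{p}`-comodules. -/
structure SumDecomposition (X : Set (OnePoint k)) (M : QuiverRep k) where
  /-- the summands -/
  component : X → QuiverRep k
  isComodule : ∀ p : X, IsComodule {p.1} (component p)
  /-- the inclusions of the summands -/
  incl : ∀ p : X, component p ⟶ M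
  isColimit : IsColimit (Cofan.mk M incl)

/-- A decomposition of `C` into a direct product, indexed by the points `p` of `X`,
of `{p}`-contramodules. -/
structure ProdDecomposition (X : Set (OnePoint k)) (C : QuiverRep k) where
  /-- the factors -/
  component : X → QuiverRep k
  isContramodule : ∀ p : X, IsContramodule {p.1} (component p)
  /-- the projections to the factors -/
  proj : ∀ p : X, C ⟶ component p
  isLimit : IsLimit (Fan.mk C proj)

/-- The functor taking a family of `{p}`-comodules, `p ∈ X`, to its direct sum. -/
noncomputable def sumFunctor (X : Set (OnePoint k)) :
    (∀ p : X, (IsComodule ({p.1} : Set (OnePoint k))).FullSubcategory) ⥤ QuiverRep k where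
  obj N := ∐ fun p => (N p).obj
  map φ := Limits.Sigma.map fun p => (φ p).hom

/-- The functor taking a family of `{p}`-contramodules, `p ∈ X`, to its direct product. -/
noncomputable def prodFunctor (X : Set (OnePoint k)) :
    (∀ p : X, (IsContramodule ({p.1} : Set (OnePoint k))).FullSubcategory) ⥤ QuiverRep k where
  obj N := ∏ᶜ fun p => (N p).obj
  map φ := Limits.Pi.map fun p => (φ p).hom

end Basic

/-- A `k`-vector space with a locally nilpotent linear operator `z`. -/
structure NilpotentSpace (k : Type u) [Field k] where
  /-- the underlying vector space -/
  carrier : ModuleCat.{u} k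
  /-- the operator -/
  z : carrier →ₗ[k] carrier
  locallyNilpotent : ∀ v : carrier, ∃ n : ℕ, (z ^ n) v = 0

namespace NilpotentSpace

variable {k : Type u} [Field k]

/-- Linear maps commuting with the operators. -/
@[ext]
structure Hom (V W : NilpotentSpace k) where
  /-- the underlying linear map -/
  toLin : V.carrier →ₗ[k] W.carrier
  comm : ∀ v, toLin (V.z v) = W.z (toLin v)

instance : Category.{u} (NilpotentSpace k) where
  Hom := Hom
  id V := ⟨LinearMap.id, fun _ => rfl⟩
  comp φ ψ := ⟨ψ.toLin ∘ₗ φ.toLin, fun v => by simp [φ.comm, ψ.comm]⟩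

end NilpotentSpace

/-- A `k`-vector space with a `z`-power infinite summation operation
`(c₀, c₁, c₂, …) ↦ ∑ zⁿ cₙ`: this operation is linear, `∑ zⁿ cₙ = c₀` if `cₙ = 0` for all `n ≥ 1`
(unitality), and `∑ᵢ zⁱ (∑ⱼ zʲ cᵢⱼ) = ∑ₙ zⁿ (∑_{i+j=n} cᵢⱼ)` (associativity). -/
structure SummationSpace (k : Type u) [Field k] where
  /-- the underlying vector space -/
  carrier : ModuleCat.{u} k
  /-- the summation operation -/
  sum : (ℕ → carrier) →ₗ[k] carrier
  sum_unital : ∀ c : ℕ → carrier, (∀ n, 1 ≤ n → c n = 0) → sum c = c 0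
  sum_assoc : ∀ c : ℕ → ℕ → carrier,
    sum (fun i => sum (c i)) =
      sum fun n => ∑ ij ∈ Finset.HasAntidiagonal.antidiagonal n, c ij.1 ij.2

namespace SummationSpace

variable {k : Type u} [Field k]

/-- Linear maps preserving the infinite summation operations. -/
@[ext]
structure Hom (C D : SummationSpace k) where
  /-- the underlying linear map -/
  toLin : C.carrier →ₗ[k] D.carrier
  map_sum : ∀ c : ℕ → C.carrier, toLin (C.sum c) = D.sum fun n => toLin (c n)

instance : Category.{u} (SummationSpace k) where
  Hom := Hom
  id C := ⟨LinearMap.id, fun _ => rfl⟩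
  comp φ ψ := ⟨ψ.toLin ∘ₗ φ.toLin, fun c => by simp [φ.map_sum, ψ.map_sum]⟩

end SummationSpace

end KroneckerQuiver

open KroneckerQuiver

namespace KroneckerQuiver

variable {k : Type u} [Field k]

/-! Choose coordinates of the pencil at a point `p`, with `u` the map at `p` and `w` a second
spanning map; for `q ≠ p` the map at `q` is `α u + β w` with `β ≠ 0`. A standard projective
resolution turns `Ext¹(V, W) = 0` into the solvability of `φ = u a - b u`, `ψ = w a - b w`.

At one point, testing against representations with `u = id` shows that a `{p}`-comodule is `(M, M,
z, id)` with `z` locally nilpotent, and a `{p}`-contramodule is `(C, C, z, id)` where each system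
`aₙ - z aₙ₊₁ = cₙ` has a unique solution (`isComodule_singleton_iff`,
`isContramodule_singleton_iff`). Conversely, the geometric series `∑ yⁿ c zⁿ` and `∑ zⁿ c yⁿ` solve
the `Ext¹` equations. In both cases `α z + β` is invertible, so the map at every other point is
bijective.

For general `X`, the candidate component of a comodule `M` at `p` is `localPart M p`, and that of a
contramodule `C` is the completion `C₂[[z]] / (u - z w) C₁[[z]]`. The canonical maps `localPartHom`
and `completionHom` are bicartesian at `p`: their cones are invertible there. The property needed of
`M` or `C` comes from the Laurent series field, a representation invertible at all points
(`exists_recursion`, `eq_zero_of_recursion`). The inclusion of the `p`-th summand into the direct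
sum of the candidates is also bicartesian at `p`, because the other summands are invertible there.
By two-out-of-three the comparison map between the sum and `M` is bicartesian at every point of `X`,
so its kernel and cokernel lie in `𝒱_X`. The vanishing of `Hom` and `Ext¹` then makes it an
isomorphism (`isIso_of_isBicartAt`); products are dual.

Functoriality and uniqueness hold because the cokernel of the `p`-th inclusion is invertible at `p`
and so receives no nonzero map from a `{p}`-comodule; dually for kernels of projections. -/

/-! ### Morphisms, elementwise exactness and the pencil of maps -/

/-- The representation with structure maps `f` and `g`. -/
abbrev ofPair {A B : Type u} [AddCommGroup A] [Module k A] [AddCommGroup B] [Module k B]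
    (f g : A →ₗ[k] B) : QuiverRep k :=
  parallelPair (ModuleCat.ofHom f) (ModuleCat.ofHom g)

/-- The second map of the pencil at a point `p`: together with `mapAt V p` it spans the pencil. -/
def coMapAt (V : QuiverRep k) : OnePoint k → (V.obj .zero ⟶ V.obj .one)
  | .infty => gMap V
  | .some _ => fMap V

/-- `mapAt` as a linear map. -/
abbrev uMap (V : QuiverRep k) (p : OnePoint k) : V.obj .zero →ₗ[k] V.obj .one := (mapAt V p).hom

/-- `coMapAt` as a linear map. -/
abbrev wMap (V : QuiverRep k) (p : OnePoint k) : V.obj .zero →ₗ[k] V.obj .one := (coMapAt V p).hom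

theorem isIso_mapAt_iff (V : QuiverRep k) (p : OnePoint k) :
    IsIso (mapAt V p) ↔ Function.Bijective (uMap V p) :=
  ConcreteCategory.isIso_iff_bijective _

/-- Distinct points give linearly independent members of the pencil, whence `β ≠ 0`. The
coefficients depend on the points only and serve all representations at once. -/
theorem exists_uMap_eq {p q : OnePoint k} (h : p ≠ q) :
    ∃ α β : k, β ≠ 0 ∧ ∀ V : QuiverRep k, uMap V q = α • uMap V p + β • wMap V p := by
  rcases p with _ | c <;> rcases q with _ | d
  · exact absurd rfl h
  · refine ⟨-d, 1, one_ne_zero, fun V => ?_⟩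
    change (gMap V - d • fMap V).hom = -d • (fMap V).hom + (1 : k) • (gMap V).hom
    simp; abel
  · refine ⟨0, 1, one_ne_zero, fun V => ?_⟩
    change (fMap V).hom = (0 : k) • (gMap V - c • fMap V).hom + (1 : k) • (fMap V).hom
    simp
  · refine ⟨1, c - d, ?_, fun V => ?_⟩
    · rintro h0
      exact h (congrArg _ (sub_eq_zero.mp h0))
    · change (gMap V - d • fMap V).hom = (1 : k) • (gMap V - c • fMap V).hom + (c - d) • (fMap V).hom
      simp [sub_smul]

section ofMaps

variable {A B : Type u} [AddCommGroup A] [Module k A] [AddCommGroup B] [Module k B]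

/-- The representation whose maps `mapAt` and `coMapAt` at `p` are the given ones. -/
def ofMaps : OnePoint k → (A →ₗ[k] B) → (A →ₗ[k] B) → QuiverRep k
  | .infty, u, w => ofPair u w
  | .some c, u, w => ofPair w (u + c • w)

/-- The space at the first vertex of `ofMaps p u w`. -/
def ofMapsZero (p : OnePoint k) (u w : A →ₗ[k] B) : A ≃ₗ[k] (ofMaps p u w).obj .zero :=
  match p with
  | .infty => LinearEquiv.refl k A
  | .some _ => LinearEquiv.refl k A

/-- The space at the second vertex of `ofMaps p u w`. -/
def ofMapsOne (p : OnePoint k) (u w : A →ₗ[k] B) : B ≃ₗ[k] (ofMaps p u w).obj .one :=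
  match p with
  | .infty => LinearEquiv.refl k B
  | .some _ => LinearEquiv.refl k B

@[simp]
theorem uMap_ofMaps (p : OnePoint k) (u w : A →ₗ[k] B) (x : A) :
    uMap (ofMaps p u w) p (ofMapsZero p u w x) = ofMapsOne p u w (u x) := by
  rcases p with _ | c
  · rfl
  · change (u + c • w) x - c • w x = u x
    simp

@[simp]
theorem wMap_ofMaps (p : OnePoint k) (u w : A →ₗ[k] B) (x : A) :
    wMap (ofMaps p u w) p (ofMapsZero p u w x) = ofMapsOne p u w (w x) := by
  rcases p with _ | c <;> rfl

end ofMaps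

section homMk

variable {V W : QuiverRep k}

theorem hom_ext {φ ψ : V ⟶ W} (h0 : ∀ x, (φ.app .zero).hom x = (ψ.app .zero).hom x)
    (h1 : ∀ x, (φ.app .one).hom x = (ψ.app .one).hom x) : φ = ψ := by
  ext j x
  cases j
  · exact h0 x
  · exact h1 x

/-- A morphism of representations from a pair of linear maps commuting with the structure maps. -/
def homOfPair (a : V.obj .zero →ₗ[k] W.obj .zero) (b : V.obj .one →ₗ[k] W.obj .one)
    (hf : ∀ x, b ((fMap V).hom x) = (fMap W).hom (a x))
    (hg : ∀ x, b ((gMap V).hom x) = (gMap W).hom (a x)) : V ⟶ W where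
  app
    | .zero => ModuleCat.ofHom a
    | .one => ModuleCat.ofHom b
  naturality := by
    rintro _ _ (_ | _ | _)
    · ext x; exact hf x
    · ext x; exact hg x
    · simp

/-- A morphism of representations from a pair of linear maps commuting with the maps at `p`. -/
def homMk (p : OnePoint k) (a : V.obj .zero →ₗ[k] W.obj .zero) (b : V.obj .one →ₗ[k] W.obj .one)
    (hu : ∀ x, b (uMap V p x) = uMap W p (a x)) (hw : ∀ x, b (wMap V p x) = wMap W p (a x)) :
    V ⟶ W :=
  homOfPair a b
    (by
      rcases p with _ | c
      · exact hu
      · exact hw)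
    (by
      rcases p with _ | c
      · exact hw
      · intro x
        have h1 : b ((gMap V).hom x - c • (fMap V).hom x)
          = (gMap W).hom (a x) - c • (fMap W).hom (a x) := hu x
        have h2 : b ((fMap V).hom x) = (fMap W).hom (a x) := hw x
        rw [map_sub, map_smul, h2] at h1
        exact sub_left_injective h1)

@[simp]
theorem homMk_zero (p : OnePoint k) (a : V.obj .zero →ₗ[k] W.obj .zero)
    (b : V.obj .one →ₗ[k] W.obj .one) (hu hw) :
    ((homMk p a b hu hw).app .zero).hom = a := rfl

@[simp]
theorem homMk_one (p : OnePoint k) (a : V.obj .zero →ₗ[k] W.obj .zero)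
    (b : V.obj .one →ₗ[k] W.obj .one) (hu hw) :
    ((homMk p a b hu hw).app .one).hom = b := rfl

theorem app_uMap (φ : V ⟶ W) (p : OnePoint k) (x : V.obj .zero) :
    (φ.app .one).hom (uMap V p x) = uMap W p ((φ.app .zero).hom x) := by
  have hf : (φ.app .one).hom ((fMap V).hom x) = (fMap W).hom ((φ.app .zero).hom x) :=
    NatTrans.naturality_apply φ WalkingParallelPairHom.left x
  have hg : (φ.app .one).hom ((gMap V).hom x) = (gMap W).hom ((φ.app .zero).hom x) :=
    NatTrans.naturality_apply φ WalkingParallelPairHom.right x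
  rcases p with _ | c
  · exact hf
  · change (φ.app .one).hom ((gMap V).hom x - c • (fMap V).hom x) =
      (gMap W).hom ((φ.app .zero).hom x) - c • (fMap W).hom ((φ.app .zero).hom x)
    rw [map_sub, map_smul, hf, hg]

theorem app_wMap (φ : V ⟶ W) (p : OnePoint k) (x : V.obj .zero) :
    (φ.app .one).hom (wMap V p x) = wMap W p ((φ.app .zero).hom x) := by
  rcases p with _ | c
  · exact NatTrans.naturality_apply φ WalkingParallelPairHom.right x
  · exact NatTrans.naturality_apply φ WalkingParallelPairHom.left x

end homMk

/-- Evaluation at a vertex commutes with homology, and a functor with zero values is zero. -/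
theorem exact_iff_app (S : ShortComplex (QuiverRep k)) :
    S.Exact ↔ ∀ j, Function.Exact (S.f.app j).hom (S.g.app j).hom := by
  have key : ∀ j, Function.Exact (S.f.app j).hom (S.g.app j).hom ↔
      IsZero (S.homology.obj j) := fun j => by
    refine Iff.trans ?_ (S.mapHomologyIso ((evaluation _ (ModuleCat.{u} k)).obj j)).isZero_iff
    rw [← ShortComplex.exact_iff_isZero_homology,
      ShortComplex.ShortExact.moduleCat_exact_iff_function_exact]
    rfl
  rw [ShortComplex.exact_iff_isZero_homology]
  simp only [key]
  refine ⟨fun h j => ?_, fun h => Functor.isZero _ h⟩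
  exact Functor.map_isZero ((evaluation _ (ModuleCat.{u} k)).obj j) h

theorem mono_iff_app {V W : QuiverRep k} (φ : V ⟶ W) :
    Mono φ ↔ ∀ j, Function.Injective (φ.app j).hom := by
  rw [NatTrans.mono_iff_mono_app]
  exact forall_congr' fun j => ModuleCat.mono_iff_injective _

theorem epi_iff_app {V W : QuiverRep k} (φ : V ⟶ W) :
    Epi φ ↔ ∀ j, Function.Surjective (φ.app j).hom := by
  rw [NatTrans.epi_iff_epi_app]
  exact forall_congr' fun j => ModuleCat.epi_iff_surjective _

theorem comp_app_hom {U V W : QuiverRep k} (φ : U ⟶ V) (ψ : V ⟶ W) (j : WalkingParallelPair)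
    (x : U.obj j) : ((φ ≫ ψ).app j).hom x = (ψ.app j).hom ((φ.app j).hom x) := rfl

/-! ### `Ext¹` via the standard projective resolution -/

section resolution

variable (V : QuiverRep k)

/-- The projective representation in the standard resolution of `V`. -/
abbrev resolutionMid : QuiverRep k :=
  ofPair (LinearMap.inl k (V.obj .zero) (V.obj .zero × V.obj .one))
    (LinearMap.inr k (V.obj .zero) (V.obj .zero × V.obj .one) ∘ₗ
      LinearMap.inl k (V.obj .zero) (V.obj .one))

/-- The first syzygy in the standard resolution of `V`. -/
abbrev resolutionKer : QuiverRep k :=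
  ofPair (0 : PUnit.{u + 1} →ₗ[k] V.obj .zero × V.obj .zero) 0

/-- The inclusion of the first syzygy in the standard resolution of `V`. -/
def resolutionIncl : resolutionKer V ⟶ resolutionMid V :=
  homOfPair (0 : PUnit.{u + 1} →ₗ[k] V.obj .zero)
    ((LinearMap.fst k _ _).prod ((LinearMap.snd k _ _).prod
      (-((fMap V).hom ∘ₗ LinearMap.fst k _ _ + (gMap V).hom ∘ₗ LinearMap.snd k _ _))) :
      (V.obj .zero × V.obj .zero) →ₗ[k] (V.obj .zero × V.obj .zero × V.obj .one))
    (fun _ => (map_zero _).trans (map_zero (LinearMap.inl k (V.obj .zero) _)).symm)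
    (fun _ => (map_zero _).trans (map_zero (LinearMap.inr k (V.obj .zero) _ ∘ₗ
      LinearMap.inl k (V.obj .zero) (V.obj .one))).symm)

/-- The augmentation of the standard resolution of `V`. -/
def resolutionProj : resolutionMid V ⟶ V :=
  homOfPair (LinearMap.id : V.obj .zero →ₗ[k] V.obj .zero)
    ((fMap V).hom.coprod ((gMap V).hom.coprod LinearMap.id) :
      (V.obj .zero × V.obj .zero × V.obj .one) →ₗ[k] V.obj .one)
    (fun x => by
      change (fMap V).hom x + ((gMap V).hom 0 + 0) = (fMap V).hom x
      simp)
    (fun x => by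
      change (fMap V).hom 0 + ((gMap V).hom x + 0) = (gMap V).hom x
      simp)

/-- The standard resolution of `V`. -/
abbrev resolutionSES : ShortComplex (QuiverRep k) :=
  ShortComplex.mk (resolutionIncl V) (resolutionProj V) (by
    apply hom_ext
    · intro x
      rfl
    · intro x
      change (fMap V).hom x.1 + ((gMap V).hom x.2 + -((fMap V).hom x.1 + (gMap V).hom x.2)) = 0
      abel)

/-- The middle term is freely generated by `V₁` at the first vertex and `V₂` at the second; a
relation `(a, b, c)` is determined by `a` and `b`, since `c = -(f a + g b)`. -/
theorem resolutionSES_shortExact : (resolutionSES V).ShortExact where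
  exact := by
    rw [exact_iff_app]
    rintro (_ | _) x
    · constructor
      · intro hx
        exact ⟨PUnit.unit, Eq.symm hx⟩
      · rintro ⟨y, rfl⟩
        rfl
    · obtain ⟨a, b, c⟩ := x
      change (fMap V).hom a + ((gMap V).hom b + c) = 0 ↔ ∃ y : V.obj .zero × V.obj .zero,
        ((y.1, y.2, -((fMap V).hom y.1 + (gMap V).hom y.2)) : V.obj .zero × V.obj .zero × V.obj .one)
          = (a, b, c)
      constructor
      · intro h
        refine ⟨(a, b), ?_⟩
        rw [← add_assoc] at h
        simp only [neg_eq_of_add_eq_zero_right h]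
      · rintro ⟨y, hy⟩
        simp only [Prod.mk.injEq] at hy
        obtain ⟨rfl, rfl, rfl⟩ := hy
        abel
  mono_f := by
    rw [mono_iff_app]
    rintro (_ | _) x y h
    · rfl
    · have h' : ((x.1, x.2, -((fMap V).hom x.1 + (gMap V).hom x.2)) :
        V.obj .zero × V.obj .zero × V.obj .one) =
          (y.1, y.2, -((fMap V).hom y.1 + (gMap V).hom y.2)) := h
      simp only [Prod.mk.injEq] at h'
      exact Prod.ext h'.1 h'.2.1
  epi_g := by
    rw [epi_iff_app]
    rintro (_ | _) x
    · exact ⟨x, rfl⟩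
    · refine ⟨((0, 0, x) : V.obj .zero × V.obj .zero × V.obj .one), ?_⟩
      change (fMap V).hom 0 + ((gMap V).hom 0 + x) = x
      simp

/-- A morphism out of the middle term is a free choice of linear maps on the generators, so linear
sections of the epimorphism lift it. -/
instance : Projective (resolutionMid V) where
  factors {E Y} h e he := by
    rw [epi_iff_app] at he
    obtain ⟨s0, hs0⟩ := (e.app .zero).hom.exists_rightInverse_of_surjective
      (LinearMap.range_eq_top.mpr (he .zero))
    obtain ⟨s1, hs1⟩ := (e.app .one).hom.exists_rightInverse_of_surjective
      (LinearMap.range_eq_top.mpr (he .one))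
    let h0 : V.obj .zero →ₗ[k] Y.obj .zero := (h.app .zero).hom
    let h1 : (V.obj .zero × V.obj .zero × V.obj .one) →ₗ[k] Y.obj .one := (h.app .one).hom
    have hf : ∀ x, h1 (x, 0, 0) = (fMap Y).hom (h0 x) :=
      fun x => app_uMap h .infty x
    have hg : ∀ x, h1 (0, x, 0) = (gMap Y).hom (h0 x) :=
      fun x => app_wMap h .infty x
    refine ⟨homOfPair (s0 ∘ₗ h0 : V.obj .zero →ₗ[k] E.obj .zero)
      (((fMap E).hom ∘ₗ s0 ∘ₗ h0).coprod (((gMap E).hom ∘ₗ s0 ∘ₗ h0).coprod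
        (s1 ∘ₗ h1 ∘ₗ LinearMap.inr k _ _ ∘ₗ LinearMap.inr k _ _)) :
          (V.obj .zero × V.obj .zero × V.obj .one) →ₗ[k] E.obj .one) ?_ ?_, ?_⟩
    · intro x
      change (fMap E).hom (s0 (h0 x)) + ((gMap E).hom (s0 (h0 0)) + s1 (h1 0)) =
        (fMap E).hom (s0 (h0 x))
      simp
    · intro x
      change (fMap E).hom (s0 (h0 0)) + ((gMap E).hom (s0 (h0 x)) + s1 (h1 0)) =
        (gMap E).hom (s0 (h0 x))
      simp
    · apply hom_ext
      · intro x
        exact LinearMap.congr_fun hs0 (h0 x)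
      · rintro ⟨a, b, c⟩
        change (e.app .one).hom ((fMap E).hom (s0 (h0 a)) + ((gMap E).hom (s0 (h0 b)) +
          s1 (h1 (0, 0, c)))) = h1 (a, b, c)
        have e0 : ∀ y, (e.app .zero).hom (s0 y) = y := LinearMap.congr_fun hs0
        have e1 : ∀ y, (e.app .one).hom (s1 y) = y := LinearMap.congr_fun hs1
        have ef : ∀ y, (e.app .one).hom ((fMap E).hom y) = (fMap Y).hom ((e.app .zero).hom y) :=
          app_uMap e .infty
        have eg : ∀ y, (e.app .one).hom ((gMap E).hom y) = (gMap Y).hom ((e.app .zero).hom y) :=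
          app_wMap e .infty
        rw [map_add, map_add, ef, eg, e0, e0, e1, ← hf, ← hg, ← map_add, ← map_add]
        simp

end resolution

/-- The explicit form of the vanishing of `Ext¹(V, W)`. -/
def ExtVanish (p : OnePoint k) (V W : QuiverRep k) : Prop :=
  ∀ φ ψ : V.obj .zero →ₗ[k] W.obj .one, ∃ (a : V.obj .zero →ₗ[k] W.obj .zero)
    (b : V.obj .one →ₗ[k] W.obj .one), ∀ x, φ x = uMap W p (a x) - b (uMap V p x) ∧
      ψ x = wMap W p (a x) - b (wMap V p x)

/-- By projectivity `Ext¹(V, W)` is the cokernel of restriction from the middle term to the syzygy.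
Maps from the syzygy are pairs `(φ, ψ)`, maps from the middle term are pairs `(a, b)`, and
restriction is `(f a - b f, g a - b g)`. -/
theorem extVanish_infty_iff (V W : QuiverRep k) :
    ExtVanish .infty V W ↔ ∀ e : Abelian.Ext V W 1, e = 0 := by
  have hS := resolutionSES_shortExact V
  constructor
  · intro H e
    obtain ⟨x₁, rfl⟩ := Abelian.Ext.contravariant_sequence_exact₃ hS W e
      (Abelian.Ext.eq_zero_of_projective _) (add_zero 1)
    obtain ⟨κ, rfl⟩ := (Abelian.Ext.mk₀_bijective _ _).2 x₁
    let κ1 : (V.obj .zero × V.obj .zero) →ₗ[k] W.obj .one := (κ.app .one).hom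
    obtain ⟨a, b, hab⟩ := H (κ1 ∘ₗ LinearMap.inl k _ _) (κ1 ∘ₗ LinearMap.inr k _ _)
    let h : resolutionMid V ⟶ W := homOfPair (a : V.obj .zero →ₗ[k] W.obj .zero)
      (((fMap W).hom ∘ₗ a).coprod (((gMap W).hom ∘ₗ a).coprod b) :
        (V.obj .zero × V.obj .zero × V.obj .one) →ₗ[k] W.obj .one)
      (fun x => by
        change (fMap W).hom (a x) + ((gMap W).hom (a 0) + b 0) = (fMap W).hom (a x)
        simp)
      (fun x => by
        change (fMap W).hom (a 0) + ((gMap W).hom (a x) + b 0) = (gMap W).hom (a x)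
        simp)
    have hκ : κ = resolutionIncl V ≫ h := by
      apply hom_ext
      · intro x
        exact (map_zero (κ.app .zero).hom).trans (map_zero a).symm
      · rintro ⟨x, y⟩
        change κ1 (x, y) = (fMap W).hom (a x) + ((gMap W).hom (a y) +
          b (-((fMap V).hom x + (gMap V).hom y)))
        have h1 : κ1 (x, 0) = (fMap W).hom (a x) - b ((fMap V).hom x) := (hab x).1
        have h2 : κ1 (0, y) = (gMap W).hom (a y) - b ((gMap V).hom y) := (hab y).2
        have h3 : κ1 (x, y) = κ1 (x, 0) + κ1 (0, y) := by rw [← map_add]; simp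
        rw [h3, h1, h2, map_neg, map_add]
        abel
    rw [hκ, ← Abelian.Ext.mk₀_comp_mk₀]
    exact hS.extClass_comp_assoc _
  · intro H φ ψ
    let κ : resolutionKer V ⟶ W := homOfPair (0 : PUnit.{u + 1} →ₗ[k] W.obj .zero)
      (φ.coprod ψ : (V.obj .zero × V.obj .zero) →ₗ[k] W.obj .one)
      (fun x => (map_zero _).trans (map_zero (fMap W).hom).symm)
      (fun x => (map_zero _).trans (map_zero (gMap W).hom).symm)
    obtain ⟨x₂, hx₂⟩ := Abelian.Ext.contravariant_sequence_exact₁ hS W (Abelian.Ext.mk₀ κ)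
      (add_zero 1) (H _)
    obtain ⟨h, rfl⟩ := (Abelian.Ext.mk₀_bijective _ _).2 x₂
    rw [Abelian.Ext.mk₀_comp_mk₀] at hx₂
    have hκ : resolutionIncl V ≫ h = κ := (Abelian.Ext.mk₀_bijective _ _).1 hx₂
    let h0 : V.obj .zero →ₗ[k] W.obj .zero := (h.app .zero).hom
    let h1 : (V.obj .zero × V.obj .zero × V.obj .one) →ₗ[k] W.obj .one := (h.app .one).hom
    have hf : ∀ x, h1 (x, 0, 0) = (fMap W).hom (h0 x) :=
      fun x => app_uMap h .infty x
    have hg : ∀ x, h1 (0, x, 0) = (gMap W).hom (h0 x) :=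
      fun x => app_wMap h .infty x
    have key : ∀ x y, φ x + ψ y = h1 (x, y, -((fMap V).hom x + (gMap V).hom y)) := fun x y =>
      LinearMap.congr_fun (congrArg ModuleCat.Hom.hom (NatTrans.congr_app hκ.symm .one))
        ((x, y) : V.obj .zero × V.obj .zero)
    refine ⟨h0, h1 ∘ₗ LinearMap.inr k _ _ ∘ₗ LinearMap.inr k _ _, fun x => ⟨?_, ?_⟩⟩
    · have := key x 0
      rw [map_zero, add_zero, map_zero, add_zero] at this
      change φ x = (fMap W).hom (h0 x) - h1 (0, 0, (fMap V).hom x)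
      rw [this, ← hf, ← map_sub]
      simp
    · have := key 0 x
      rw [map_zero, zero_add, map_zero, zero_add] at this
      change ψ x = (gMap W).hom (h0 x) - h1 (0, 0, (gMap V).hom x)
      rw [this, ← hg, ← map_sub]
      simp

/-- At a finite point `c` the same `a` and `b` work after the invertible substitution `(φ, ψ) ↦ (ψ -
c φ, φ)`. -/
theorem extVanish_iff (p : OnePoint k) (V W : QuiverRep k) :
    ExtVanish p V W ↔ ∀ e : Abelian.Ext V W 1, e = 0 := by
  rw [← extVanish_infty_iff]
  rcases p with _ | c
  · rfl
  · constructor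
    · intro H φ ψ
      obtain ⟨a, b, hab⟩ := H (ψ - c • φ) φ
      refine ⟨a, b, fun x => ⟨(hab x).2, ?_⟩⟩
      have h1 : ψ x - c • φ x = ((gMap W).hom (a x) - c • (fMap W).hom (a x)) -
        b ((gMap V).hom x - c • (fMap V).hom x) := (hab x).1
      have h2 : φ x = (fMap W).hom (a x) - b ((fMap V).hom x) := (hab x).2
      change ψ x = (gMap W).hom (a x) - b ((gMap V).hom x)
      rw [h2, map_sub, map_smul, smul_sub, sub_eq_iff_eq_add] at h1
      rw [h1]
      abel
    · intro H φ ψ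
      obtain ⟨a, b, hab⟩ := H ψ (φ + c • ψ)
      refine ⟨a, b, fun x => ⟨?_, (hab x).1⟩⟩
      have h1 : φ x + c • ψ x = (gMap W).hom (a x) - b ((gMap V).hom x) := (hab x).2
      have h2 : ψ x = (fMap W).hom (a x) - b ((fMap V).hom x) := (hab x).1
      change φ x = ((gMap W).hom (a x) - c • (fMap W).hom (a x)) -
        b ((gMap V).hom x - c • (fMap V).hom x)
      rw [h2, smul_sub, ← eq_sub_iff_add_eq] at h1
      rw [map_sub, map_smul, h1]
      abel

/-! ### Comodules and contramodules at one point -/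

/-! ### Geometric series of locally nilpotent operators and of operators with bijective `telescope`.
-/

section linearAlgebra

variable {A B : Type*} [AddCommGroup A] [Module k A] [AddCommGroup B] [Module k B]

/-- The solution is `b = ∑ yⁿ c zⁿ`, a finite sum on each vector. -/
theorem exists_linearMap_sub_eq_of_locallyNilpotent {z : A →ₗ[k] A}
    (hz : ∀ m, ∃ n : ℕ, (z ^ n) m = 0) (y : B →ₗ[k] B) (c : A →ₗ[k] B) :
    ∃ b : A →ₗ[k] B, ∀ m, b m - y (b (z m)) = c m := by
  have hz' : ∀ {m : A} {N i : ℕ}, (z ^ N) m = 0 → N ≤ i → (z ^ i) m = 0 := fun {m N i} h hi => by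
    rw [← Nat.sub_add_cancel hi, pow_add, Module.End.mul_apply, h, map_zero]
  have hsupp : ∀ m N, (z ^ N) m = 0 →
      Function.support (fun n : ℕ => (y ^ n) (c ((z ^ n) m))) ⊆ Finset.range N := by
    intro m N hN i hi
    by_contra hi'
    apply hi
    have : N ≤ i := by simpa using hi'
    simp [hz' hN this]
  have hfin : ∀ m, (Function.support (fun n : ℕ => (y ^ n) (c ((z ^ n) m)))).Finite := fun m => by
    obtain ⟨N, hN⟩ := hz m
    exact (Finset.finite_toSet _).subset (hsupp m N hN)
  refine ⟨{ toFun := fun m => ∑ᶠ n : ℕ, (y ^ n) (c ((z ^ n) m))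
            map_add' := fun m m' => ?_
            map_smul' := fun r m => ?_ }, fun m => ?_⟩
  · rw [← finsum_add_distrib (hfin m) (hfin m')]
    simp
  · simp only [map_smul, RingHom.id_apply]
    rw [smul_finsum]
  · obtain ⟨N, hN⟩ := hz m
    have h1 : (z ^ (N + 1)) m = 0 := hz' hN (Nat.le_succ N)
    have h2 : (z ^ N) (z m) = 0 := by rwa [pow_succ] at h1
    change (∑ᶠ n : ℕ, (y ^ n) (c ((z ^ n) m))) - y (∑ᶠ n : ℕ, (y ^ n) (c ((z ^ n) (z m)))) = c m
    rw [finsum_eq_sum_of_support_subset _ (hsupp m _ h1),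
      finsum_eq_sum_of_support_subset _ (hsupp (z m) N h2), Finset.sum_range_succ', map_sum]
    simp [pow_succ' y, pow_succ z]

theorem eq_zero_of_eq_comp_of_locallyNilpotent {z : A →ₗ[k] A}
    (hz : ∀ m, ∃ n : ℕ, (z ^ n) m = 0) (y : B →ₗ[k] B) (b : A →ₗ[k] B)
    (hb : ∀ m, b m = y (b (z m))) (m : A) : b m = 0 := by
  have key : ∀ (n : ℕ) (m : A), (z ^ n) m = 0 → b m = 0 := by
    intro n
    induction n with
    | zero => intro m hm; rw [show m = 0 from hm, map_zero]
    | succ n ih =>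
      intro m hm
      rw [hb, ih (z m) (by rwa [pow_succ] at hm), map_zero]
  obtain ⟨n, hn⟩ := hz m
  exact key n m hn

/-- The operator `(aₙ) ↦ (aₙ - z aₙ₊₁)` on sequences. -/
def telescope (z : A →ₗ[k] A) : (ℕ → A) →ₗ[k] (ℕ → A) where
  toFun a n := a n - z (a (n + 1))
  map_add' a b := by ext n; simp; abel
  map_smul' r a := by ext n; simp [smul_sub]

theorem telescope_apply (z : A →ₗ[k] A) (a : ℕ → A) (n : ℕ) :
    telescope z a n = a n - z (a (n + 1)) := rfl

theorem eq_of_recursion {z : A →ₗ[k] A} (hz : Function.Injective (telescope z)) {c a b : ℕ → A}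
    (ha : ∀ n, a n = c n + z (a (n + 1))) (hb : ∀ n, b n = c n + z (b (n + 1))) : a = b := by
  apply hz
  ext n
  rw [telescope_apply, telescope_apply, ha, hb]
  abel

/-- The summation operation of an operator with bijective `telescope`. -/
noncomputable def telescopeSum {z : A →ₗ[k] A} (hz : Function.Bijective (telescope z)) : (ℕ → A) →ₗ[k] A :=
  LinearMap.proj 0 ∘ₗ (LinearEquiv.ofBijective (telescope z) hz).symm.toLinearMap

/-- The tail of the preimage of `c` under `telescope z` is the preimage of the tail of `c`, by
injectivity. -/
theorem telescopeSum_eq {z : A →ₗ[k] A} (hz : Function.Bijective (telescope z)) (c : ℕ → A) :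
    telescopeSum hz c = c 0 + z (telescopeSum hz fun n => c (n + 1)) := by
  let e := LinearEquiv.ofBijective (telescope z) hz
  have h1 : ∀ c n, e.symm c n - z (e.symm c (n + 1)) = c n := fun c =>
    congrFun (e.apply_symm_apply c)
  have h2 : (fun n => e.symm c (n + 1)) = e.symm fun n => c (n + 1) := by
    apply hz.1
    ext n
    exact (h1 c (n + 1)).trans (h1 (fun n => c (n + 1)) n).symm
  exact (sub_eq_iff_eq_add.1 (h1 c 0)).trans
    (congrArg (c 0 + ·) (congrArg z (congrFun h2 0)))

/-- This is how identities between infinite sums are proved below: any sequence obeying the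
recursion starts with the sum. -/
theorem telescopeSum_unique {z : A →ₗ[k] A} (hz : Function.Bijective (telescope z)) {c a : ℕ → A}
    (ha : ∀ n, a n = c n + z (a (n + 1))) : a 0 = telescopeSum hz c := by
  have := congrFun (eq_of_recursion hz.1 ha (b := fun n => telescopeSum hz fun i => c (i + n))
    fun n => by
      rw [telescopeSum_eq]
      simp only [zero_add, add_assoc, add_comm 1 n]) 0
  simpa using this

theorem telescopeSum_single_zero {z : A →ₗ[k] A} (hz : Function.Bijective (telescope z)) (v : A) :
    telescopeSum hz (Pi.single 0 v) = v := by
  rw [telescopeSum_eq, show (fun n => (Pi.single 0 v : ℕ → A) (n + 1)) = 0 from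
    funext fun n => Pi.single_eq_of_ne (by omega) _]
  simp

theorem telescopeSum_single_one {z : A →ₗ[k] A} (hz : Function.Bijective (telescope z)) (v : A) :
    telescopeSum hz (Pi.single 1 v) = z v := by
  rw [telescopeSum_eq, show (fun n => (Pi.single 1 v : ℕ → A) (n + 1)) = Pi.single 0 v from
    funext fun n => by cases n <;> simp, telescopeSum_single_zero]
  simp

/-- The solution is `a = ∑ zⁿ c yⁿ`, with the infinite sum given by `telescopeSum`. -/
theorem exists_linearMap_sub_eq_of_telescope {z : A →ₗ[k] A}
    (hz : Function.Bijective (telescope z)) (y : B →ₗ[k] B) (c : B →ₗ[k] A) :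
    ∃ a : B →ₗ[k] A, ∀ v, a v - z (a (y v)) = c v := by
  refine ⟨telescopeSum hz ∘ₗ LinearMap.pi fun n => c ∘ₗ (y ^ n), fun v => ?_⟩
  rw [LinearMap.comp_apply, telescopeSum_eq, sub_eq_iff_eq_add]
  simp only [LinearMap.pi_apply, LinearMap.comp_apply, pow_zero, Module.End.one_apply, pow_succ,
    Module.End.mul_apply]
  rfl

/-- The sequence `a (yⁿ v)` is killed by `telescope z`. -/
theorem eq_zero_of_eq_comp_of_telescope {z : A →ₗ[k] A}
    (hz : Function.Bijective (telescope z)) (y : B →ₗ[k] B) (a : B →ₗ[k] A)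
    (ha : ∀ v, a v = z (a (y v))) (v : B) : a v = 0 := by
  have : (fun n => a ((y ^ n) v)) = 0 := by
    apply hz.1
    rw [map_zero]
    ext n
    rw [telescope_apply, pow_succ', Module.End.mul_apply, ← ha, sub_self, Pi.zero_apply]
  exact congrFun this 0

theorem bijective_smul_add_of_bijective_sub {z : A →ₗ[k] A}
    (hz : ∀ r : k, Function.Bijective fun v => v - r • z v) (α : k) {β : k} (hβ : β ≠ 0) :
    Function.Bijective (fun v => α • z v + β • v) := by
  have key : (fun v => α • z v + β • v) = (fun v => β • v) ∘ fun v => v - (-(β⁻¹ * α)) • z v := by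
    ext v
    simp only [Function.comp_apply, smul_smul, neg_smul, sub_neg_eq_add, smul_add]
    rw [mul_inv_cancel_left₀ hβ, add_comm]
  rw [key]
  exact (MulAction.bijective (Units.mk0 β hβ)).comp (hz _)

theorem bijective_sub_smul_of_locallyNilpotent {z : A →ₗ[k] A}
    (hz : ∀ m, ∃ n : ℕ, (z ^ n) m = 0) (r : k) :
    Function.Bijective fun v => v - r • z v := by
  constructor
  · intro v w hvw
    rw [← sub_eq_zero]
    obtain ⟨n, hn⟩ := hz (v - w)
    have h1 : v - w = r • z (v - w) := by
      rw [map_sub, smul_sub, sub_eq_sub_iff_sub_eq_sub]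
      exact hvw
    have h2 : ∀ n : ℕ, v - w = r ^ n • (z ^ n) (v - w) := fun n => by
      induction n with
      | zero => simp
      | succ n ih =>
        rw [pow_succ z, Module.End.mul_apply, pow_succ, mul_smul, ← map_smul, ← h1]
        exact ih
    rw [h2 n, hn, smul_zero]
  · have key : ∀ (n : ℕ) (v : A), (z ^ n) v = 0 → ∃ y, y - r • z y = v := by
      intro n
      induction n with
      | zero => intro v hv; exact ⟨0, by rw [show v = 0 from hv]; simp⟩
      | succ n ih =>
        intro v hv
        obtain ⟨y, hy⟩ := ih (z v) (by rwa [pow_succ] at hv)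
        -- Geometric series: `(1 - r z)⁻¹ v = v + r (1 - r z)⁻¹ (z v)`.
        refine ⟨v + r • y, ?_⟩
        rw [map_add, map_smul, add_sub_assoc, smul_add, sub_add_eq_sub_sub, sub_right_comm,
          ← smul_sub, hy, sub_self, add_zero]
    intro v
    obtain ⟨n, hn⟩ := hz v
    exact key n v hn

theorem bijective_sub_smul_of_telescope {z : A →ₗ[k] A}
    (hz : Function.Bijective (telescope z)) (r : k) :
    Function.Bijective fun v => v - r • z v := by
  constructor
  · intro v w hvw
    rw [← sub_eq_zero]
    have h2 : (fun n : ℕ => r ^ n • (v - w)) = 0 := by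
      apply hz.1
      rw [map_zero]
      ext n
      have h1 : v - w = r • z (v - w) := by
        rw [map_sub, smul_sub, sub_eq_sub_iff_sub_eq_sub]
        exact hvw
      rw [telescope_apply, pow_succ, mul_smul, map_smul, map_smul, ← h1]
      exact sub_self _
    simpa using congrFun h2 0
  · intro v
    -- With `y = r` the equation `a - z a y = id` makes `a` a right inverse of `1 - r z`.
    obtain ⟨a, ha⟩ := exists_linearMap_sub_eq_of_telescope hz (r • LinearMap.id) LinearMap.id
    refine ⟨a v, ?_⟩
    have := ha v
    simpa using this

end linearAlgebra

theorem isComodule_iff (p : OnePoint k) (X : Set (OnePoint k)) (M : QuiverRep k) :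
    IsComodule X M ↔ ∀ V : QuiverRep k, InvertibleOn X V →
      (∀ h : M ⟶ V, h = 0) ∧ ExtVanish p M V := by
  simp only [extVanish_iff]
  rfl

theorem isContramodule_iff (p : OnePoint k) (X : Set (OnePoint k)) (C : QuiverRep k) :
    IsContramodule X C ↔ ∀ V : QuiverRep k, InvertibleOn X V →
      (∀ h : V ⟶ C, h = 0) ∧ ExtVanish p V C := by
  simp only [extVanish_iff]
  rfl

theorem invertibleOn_iff (X : Set (OnePoint k)) (V : QuiverRep k) :
    InvertibleOn X V ↔ ∀ p ∈ X, Function.Bijective (uMap V p) :=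
  forall₂_congr fun _ _ => isIso_mapAt_iff _ _

/-! ### Representations with `u = id` as test objects. -/

section test

variable {X : Set (OnePoint k)} {A : Type u} [AddCommGroup A] [Module k A]

/-- The representation `(A, A, id, x)` in the coordinates of the pencil at `p`. -/
abbrev testRep (p : OnePoint k) (x : A →ₗ[k] A) : QuiverRep k := ofMaps p LinearMap.id x

theorem invertibleOn_singleton_testRep (p : OnePoint k) (x : A →ₗ[k] A) :
    InvertibleOn {p} (testRep p x) := by
  rw [invertibleOn_iff]
  intro q hq
  rw [Set.mem_singleton_iff.1 hq]
  have : (uMap (testRep p x) p : _ → _) ∘ ofMapsZero p LinearMap.id x =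
      ofMapsOne p LinearMap.id x := by
    ext v; simp
  rw [← Function.Bijective.of_comp_iff _ (ofMapsZero p LinearMap.id x).bijective, this]
  exact LinearEquiv.bijective _

/-- As `u = id` on the test object, the component of a morphism at the first vertex must be `b u`;
only the condition on `w` remains. -/
theorem IsComodule.hom_test {M : QuiverRep k} (hM : IsComodule X M) {p : OnePoint k}
    {x : A →ₗ[k] A} (hx : InvertibleOn X (testRep p x)) (b : M.obj .one →ₗ[k] A)
    (hb : ∀ m, b (wMap M p m) = x (b (uMap M p m))) : b = 0 := by
  have := (hM _ hx).1 (homMk p ((ofMapsZero p LinearMap.id x).toLinearMap ∘ₗ b ∘ₗ uMap M p)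
    ((ofMapsOne p LinearMap.id x).toLinearMap ∘ₗ b) (fun m => by simp) (fun m => by simp [hb]))
  ext m
  have h1 : ofMapsOne p LinearMap.id x (b m) = 0 :=
    LinearMap.congr_fun (congrArg ModuleCat.Hom.hom (NatTrans.congr_app this .one)) m
  simpa using h1

/-- Taking the pair `(0, c)`, the first equation forces `a = b u`, and the second becomes a single
equation for `b`. -/
theorem IsComodule.ext_test {M : QuiverRep k} (hM : IsComodule X M) {p : OnePoint k}
    {x : A →ₗ[k] A} (hx : InvertibleOn X (testRep p x)) (c : M.obj .zero →ₗ[k] A) :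
    ∃ b : M.obj .one →ₗ[k] A, ∀ m, c m = x (b (uMap M p m)) - b (wMap M p m) := by
  obtain ⟨a, b, hab⟩ := ((isComodule_iff p X M).1 hM _ hx).2 0
    ((ofMapsOne p LinearMap.id x).toLinearMap ∘ₗ c)
  refine ⟨(ofMapsOne p LinearMap.id x).symm.toLinearMap ∘ₗ b, fun m => ?_⟩
  obtain ⟨h1, h2⟩ := hab m
  obtain ⟨y, hy⟩ := (ofMapsZero p LinearMap.id x).surjective (a m)
  rw [← hy, uMap_ofMaps, LinearMap.zero_apply, eq_comm, sub_eq_zero] at h1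
  rw [← hy, wMap_ofMaps] at h2
  apply (ofMapsOne p LinearMap.id x).injective
  simp only [LinearMap.comp_apply, LinearEquiv.coe_coe, map_sub, LinearEquiv.apply_symm_apply,
    ← h1, LinearEquiv.symm_apply_apply] at h2 ⊢
  exact h2

theorem IsContramodule.hom_test {C : QuiverRep k} (hC : IsContramodule X C) {p : OnePoint k}
    {x : A →ₗ[k] A} (hx : InvertibleOn X (testRep p x)) (a : A →ₗ[k] C.obj .zero)
    (ha : ∀ v, wMap C p (a v) = uMap C p (a (x v))) : a = 0 := by
  have := (hC _ hx).1 (homMk p (a ∘ₗ (ofMapsZero p LinearMap.id x).symm.toLinearMap)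
    (uMap C p ∘ₗ a ∘ₗ (ofMapsOne p LinearMap.id x).symm.toLinearMap)
    (fun m => by
      obtain ⟨m, rfl⟩ := (ofMapsZero p LinearMap.id x).surjective m
      simp)
    (fun m => by
      obtain ⟨m, rfl⟩ := (ofMapsZero p LinearMap.id x).surjective m
      simp [ha]))
  ext m
  have h1 : a ((ofMapsZero p LinearMap.id x).symm (ofMapsZero p LinearMap.id x m)) = 0 :=
    LinearMap.congr_fun (congrArg ModuleCat.Hom.hom (NatTrans.congr_app this .zero)) _
  simpa using h1

theorem IsContramodule.ext_test {C : QuiverRep k} (hC : IsContramodule X C) {p : OnePoint k}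
    {x : A →ₗ[k] A} (hx : InvertibleOn X (testRep p x)) (c : A →ₗ[k] C.obj .one) :
    ∃ a : A →ₗ[k] C.obj .zero, ∀ v, c v = wMap C p (a v) - uMap C p (a (x v)) := by
  obtain ⟨a, b, hab⟩ := ((isContramodule_iff p X C).1 hC _ hx).2 0
    (c ∘ₗ (ofMapsZero p LinearMap.id x).symm.toLinearMap)
  refine ⟨a ∘ₗ (ofMapsZero p LinearMap.id x).toLinearMap, fun v => ?_⟩
  have h1 := (hab (ofMapsZero p LinearMap.id x (x v))).1
  have h2 := (hab (ofMapsZero p LinearMap.id x v)).2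
  rw [uMap_ofMaps, LinearMap.zero_apply, eq_comm, sub_eq_zero] at h1
  rw [wMap_ofMaps] at h2
  simp only [LinearMap.comp_apply, LinearEquiv.coe_coe, LinearEquiv.symm_apply_apply,
    LinearMap.id_apply] at h1 h2 ⊢
  rw [h1]
  exact h2

end test

/-- At `p`, the representation is `(M, M, z, id)` with `z` locally nilpotent. -/
def IsLocallyNilpotentAt (p : OnePoint k) (M : QuiverRep k) : Prop :=
  Function.Bijective (wMap M p) ∧ ∃ z : M.obj .one →ₗ[k] M.obj .one,
    (∀ x, z (wMap M p x) = uMap M p x) ∧ ∀ m, ∃ n : ℕ, (z ^ n) m = 0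

/-- At `p`, the representation is `(C, C, z, id)` with the infinite sums `∑ zⁿ cₙ` determined
by their recursion. -/
def IsSummableAt (p : OnePoint k) (C : QuiverRep k) : Prop :=
  Function.Bijective (wMap C p) ∧ ∃ z : C.obj .one →ₗ[k] C.obj .one,
    (∀ x, z (wMap C p x) = uMap C p x) ∧ Function.Bijective (telescope z)

theorem bijective_uMap_of_ne {p q : OnePoint k} (hpq : p ≠ q) {M : QuiverRep k}
    (hw : Function.Bijective (wMap M p)) {z : M.obj .one →ₗ[k] M.obj .one}
    (hz : ∀ x, z (wMap M p x) = uMap M p x)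
    (h : ∀ r : k, Function.Bijective fun v => v - r • z v) : Function.Bijective (uMap M q) := by
  obtain ⟨α, β, hβ, huq⟩ := exists_uMap_eq hpq
  have : (uMap M q : _ → _) = (fun v => α • z v + β • v) ∘ wMap M p := by
    ext x
    rw [huq, Function.comp_apply, hz]
    rfl
  rw [this]
  exact (bijective_smul_add_of_bijective_sub h α hβ).comp hw

theorem IsLocallyNilpotentAt.bijective_uMap {p q : OnePoint k} (hpq : p ≠ q) {M : QuiverRep k}
    (hM : IsLocallyNilpotentAt p M) : Function.Bijective (uMap M q) := by
  obtain ⟨hw, z, hz, hn⟩ := hM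
  exact bijective_uMap_of_ne hpq hw hz (bijective_sub_smul_of_locallyNilpotent hn)

theorem IsSummableAt.bijective_uMap {p q : OnePoint k} (hpq : p ≠ q) {M : QuiverRep k}
    (hM : IsSummableAt p M) : Function.Bijective (uMap M q) := by
  obtain ⟨hw, z, hz, hn⟩ := hM
  exact bijective_uMap_of_ne hpq hw hz (bijective_sub_smul_of_telescope hn)

theorem IsLocallyNilpotentAt.isComodule {p : OnePoint k} {M : QuiverRep k}
    (hM : IsLocallyNilpotentAt p M) : IsComodule {p} M := by
  obtain ⟨hw, z, hz, hn⟩ := hM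
  rw [isComodule_iff p]
  intro V hV
  rw [invertibleOn_iff] at hV
  let eu := LinearEquiv.ofBijective (uMap V p) (hV p rfl)
  let ew := LinearEquiv.ofBijective (wMap M p) hw
  have heu : ∀ y, uMap V p (eu.symm y) = y := eu.apply_symm_apply
  have heu' : ∀ y, eu.symm (uMap V p y) = y := eu.symm_apply_apply
  have hew : ∀ y, wMap M p (ew.symm y) = y := ew.apply_symm_apply
  have hew' : ∀ y, ew.symm (wMap M p y) = y := ew.symm_apply_apply
  constructor
  · intro h
    have h1 : ∀ m, (h.app .one).hom m = 0 := by
      refine eq_zero_of_eq_comp_of_locallyNilpotent hn (wMap V p ∘ₗ eu.symm.toLinearMap)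
        (h.app .one).hom fun m => ?_
      obtain ⟨x, rfl⟩ := hw.2 m
      rw [hz, app_uMap, app_wMap, LinearMap.comp_apply, LinearEquiv.coe_coe, heu']
    refine hom_ext (fun x => (hV p rfl).1 ?_) h1
    rw [← app_uMap, h1]
    exact (map_zero (uMap V p)).symm
  · intro φ ψ
    -- The first equation gives `a = u⁻¹ (φ + b u)`. Substituted into the second, with `y = w u⁻¹`
    -- on `V₂` and `u = z w` on `M`, it leaves `b - y b z = (y φ - ψ) w⁻¹`.
    obtain ⟨b, hb⟩ := exists_linearMap_sub_eq_of_locallyNilpotent hn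
      (wMap V p ∘ₗ eu.symm.toLinearMap)
      ((wMap V p ∘ₗ eu.symm.toLinearMap ∘ₗ φ - ψ) ∘ₗ ew.symm.toLinearMap)
    refine ⟨eu.symm.toLinearMap ∘ₗ (φ + b ∘ₗ uMap M p), b, fun x => ⟨?_, ?_⟩⟩
    · simp [heu]
    · have := hb (wMap M p x)
      rw [hz] at this
      simp only [LinearMap.comp_apply, LinearEquiv.coe_coe, hew', LinearMap.sub_apply] at this
      simp only [LinearMap.comp_apply, LinearEquiv.coe_coe, LinearMap.add_apply, map_add]
      rw [sub_eq_iff_eq_add] at this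
      rw [this]
      abel

theorem IsSummableAt.isContramodule {p : OnePoint k} {C : QuiverRep k}
    (hC : IsSummableAt p C) : IsContramodule {p} C := by
  obtain ⟨hw, z, hz, hn⟩ := hC
  rw [isContramodule_iff p]
  intro V hV
  rw [invertibleOn_iff] at hV
  let eu := LinearEquiv.ofBijective (uMap V p) (hV p rfl)
  let ew := LinearEquiv.ofBijective (wMap C p) hw
  have heu : ∀ y, uMap V p (eu.symm y) = y := eu.apply_symm_apply
  have heu' : ∀ y, eu.symm (uMap V p y) = y := eu.symm_apply_apply
  have hew : ∀ y, wMap C p (ew.symm y) = y := ew.apply_symm_apply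
  constructor
  · intro h
    have h0 : ∀ v, wMap C p ((h.app .zero).hom v) = 0 := by
      refine eq_zero_of_eq_comp_of_telescope hn (eu.symm.toLinearMap ∘ₗ wMap V p)
        (wMap C p ∘ₗ (h.app .zero).hom) fun v => ?_
      simp only [LinearMap.comp_apply, LinearEquiv.coe_coe]
      rw [hz, ← app_uMap, heu, app_wMap]
    have h0' : ∀ v, (h.app .zero).hom v = 0 := fun v =>
      hw.1 ((h0 v).trans (map_zero (wMap C p)).symm)
    refine hom_ext h0' fun x => ?_
    obtain ⟨y, rfl⟩ := (hV p rfl).2 x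
    rw [app_uMap, h0']
    exact map_zero (uMap C p)
  · intro φ ψ
    -- Here `a` stands for `w` composed with the required first component. The first equation gives
    -- `b = (z a - φ) u⁻¹`, and with `y = u⁻¹ w` on `V₁` the second becomes `a - z a y = ψ - φ y`.
    obtain ⟨a, ha⟩ := exists_linearMap_sub_eq_of_telescope hn
      (eu.symm.toLinearMap ∘ₗ wMap V p)
      (ψ - φ ∘ₗ eu.symm.toLinearMap ∘ₗ wMap V p)
    refine ⟨ew.symm.toLinearMap ∘ₗ a, (z ∘ₗ a - φ) ∘ₗ eu.symm.toLinearMap, fun x => ⟨?_, ?_⟩⟩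
    · simp only [LinearMap.comp_apply, LinearEquiv.coe_coe, LinearMap.sub_apply, heu', ← hz, hew]
      abel
    · have := ha x
      simp only [LinearMap.comp_apply, LinearEquiv.coe_coe, LinearMap.sub_apply] at this
      simp only [LinearMap.comp_apply, LinearEquiv.coe_coe, LinearMap.sub_apply, hew]
      rw [sub_eq_iff_eq_add] at this
      rw [this]
      abel

theorem isComodule_singleton_iff {p : OnePoint k} {M : QuiverRep k} :
    IsComodule {p} M ↔ IsLocallyNilpotentAt p M := by
  refine ⟨fun hM => ?_, IsLocallyNilpotentAt.isComodule⟩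
  -- Test objects with `w = 0`: the `Ext¹` test gives a left inverse of `w`, and the `Hom` test
  -- kills the cokernel of `w`.
  have hinj : Function.Injective (wMap M p) := by
    obtain ⟨b, hb⟩ := hM.ext_test
      (invertibleOn_singleton_testRep p (0 : M.obj .zero →ₗ[k] M.obj .zero)) LinearMap.id
    refine Function.LeftInverse.injective (g := fun m => -b m) fun m => ?_
    simpa using (hb m).symm
  have hsurj : Function.Surjective (wMap M p) := by
    have := hM.hom_test (invertibleOn_singleton_testRep p
      (0 : (M.obj .one ⧸ LinearMap.range (wMap M p)) →ₗ[k] _)) (Submodule.mkQ _) (fun m => by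
        simp)
    rw [← LinearMap.range_eq_top, ← Submodule.ker_mkQ (LinearMap.range (wMap M p)), this,
      LinearMap.ker_zero]
  let ew := LinearEquiv.ofBijective (wMap M p) ⟨hinj, hsurj⟩
  have hew' : ∀ y, ew.symm (wMap M p y) = y := ew.symm_apply_apply
  have hew : ∀ y, wMap M p (ew.symm y) = y := ew.apply_symm_apply
  let z := uMap M p ∘ₗ ew.symm.toLinearMap
  have hz : ∀ x, z (wMap M p x) = uMap M p x := fun x => congrArg (uMap M p) (hew' x)
  refine ⟨⟨hinj, hsurj⟩, z, hz, fun m => ?_⟩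
  -- The test object is `M₂[x]`. The resulting equation `b m = m + x b (z m)` forces `zⁿ m` to be
  -- the `n`-th coefficient of the polynomial `b m`, so it vanishes for some `n`.
  obtain ⟨b, hb⟩ := hM.ext_test (invertibleOn_singleton_testRep p
    (Finsupp.lmapDomain (M.obj .one) k Nat.succ)) (-(Finsupp.lsingle 0 ∘ₗ wMap M p))
  have hb' : ∀ m, b m = Finsupp.single 0 m + Finsupp.mapDomain Nat.succ (b (z m)) := fun m => by
    obtain ⟨x, rfl⟩ := hsurj m
    have := hb x
    rw [hz]
    simp only [LinearMap.neg_apply, LinearMap.comp_apply, Finsupp.lsingle_apply,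
      Finsupp.lmapDomain_apply] at this
    rw [eq_sub_iff_add_eq, neg_add_eq_iff_eq_add] at this
    exact this
  have key : ∀ n m, b m n = (z ^ n) m := by
    intro n
    induction n with
    | zero =>
      intro m
      rw [hb', Finsupp.add_apply, Finsupp.mapDomain_of_notMem_range]
      · simp
      · rintro ⟨i, hi⟩
        exact Nat.succ_ne_zero i hi
    | succ n ih =>
      intro m
      rw [hb', Finsupp.add_apply, Finsupp.single_eq_of_ne (by simp),
        Finsupp.mapDomain_apply Nat.succ_injective, ih, zero_add, pow_succ, Module.End.mul_apply]
  obtain ⟨n, hn⟩ := Infinite.exists_notMem_finset (b m).support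
  exact ⟨n, by rw [← key]; simpa using hn⟩

theorem isContramodule_singleton_iff {p : OnePoint k} {C : QuiverRep k} :
    IsContramodule {p} C ↔ IsSummableAt p C := by
  refine ⟨fun hC => ?_, IsSummableAt.isContramodule⟩
  have hsurj : Function.Surjective (wMap C p) := by
    obtain ⟨a, ha⟩ := hC.ext_test
      (invertibleOn_singleton_testRep p (0 : C.obj .one →ₗ[k] C.obj .one)) LinearMap.id
    refine fun y => ⟨a y, ?_⟩
    simpa using (ha y).symm
  have hinj : Function.Injective (wMap C p) := by
    have := hC.hom_test (invertibleOn_singleton_testRep p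
      (0 : LinearMap.ker (wMap C p) →ₗ[k] _)) (Submodule.subtype _) (fun m => by simp)
    rw [← LinearMap.ker_eq_bot, ← Submodule.range_subtype (LinearMap.ker (wMap C p)), this,
      LinearMap.range_zero]
  let ew := LinearEquiv.ofBijective (wMap C p) ⟨hinj, hsurj⟩
  have hew' : ∀ y, ew.symm (wMap C p y) = y := ew.symm_apply_apply
  have hew : ∀ y, wMap C p (ew.symm y) = y := ew.apply_symm_apply
  let z := uMap C p ∘ₗ ew.symm.toLinearMap
  have hz : ∀ x, z (wMap C p x) = uMap C p x := fun x => congrArg (uMap C p) (hew' x)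
  -- The test object is `k[x]`; a linear map out of it is a sequence, the values on `xⁿ`. The `Hom`
  -- and `Ext¹` tests become injectivity and surjectivity of `telescope z`.
  let shift : (ℕ →₀ k) →ₗ[k] (ℕ →₀ k) := Finsupp.lmapDomain k k Nat.succ
  have hshift : ∀ n, shift (Finsupp.single n 1) = Finsupp.single (n + 1) 1 := fun n => by
    simp [shift, Finsupp.lmapDomain_apply, Finsupp.mapDomain_single]
  have hinv := invertibleOn_singleton_testRep p shift
  refine ⟨⟨hinj, hsurj⟩, z, hz, ?_, fun c => ?_⟩
  · rw [injective_iff_map_eq_zero]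
    intro a ha
    have h1 : ∀ n, a n = z (a (n + 1)) := fun n => sub_eq_zero.mp (congrFun ha n)
    have := hC.hom_test hinv (Finsupp.linearCombination k fun n => ew.symm (a n)) (fun v => by
      refine LinearMap.congr_fun (f := wMap C p ∘ₗ Finsupp.linearCombination k _)
        (g := uMap C p ∘ₗ Finsupp.linearCombination k _ ∘ₗ shift) ?_ v
      ext n
      simp only [LinearMap.comp_apply, Finsupp.lsingle_apply, hshift,
        Finsupp.linearCombination_single, one_smul, hew]
      exact h1 n)
    ext n
    have h2 := LinearMap.congr_fun this (Finsupp.single n 1)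
    simpa using h2
  · obtain ⟨a, ha⟩ := hC.ext_test hinv (Finsupp.linearCombination k c)
    refine ⟨fun n => wMap C p (a (Finsupp.single n 1)), ?_⟩
    ext n
    have := ha (Finsupp.single n 1)
    rw [hshift, Finsupp.linearCombination_single, one_smul] at this
    rw [telescope_apply, hz, this]

/-! ### The generic representation -/

section Laurent

/-- Multiplication by `t⁻¹` on Laurent series in `t`. -/
noncomputable def laurentX : LaurentSeries k →ₗ[k] LaurentSeries k where
  toFun s := HahnSeries.single (-1) 1 * s
  map_add' s t := mul_add _ _ _
  map_smul' r s := by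
    ext n
    simp [HahnSeries.coeff_single_mul]

theorem laurentX_coeff (s : LaurentSeries k) (n : ℤ) : (laurentX s).coeff n = s.coeff (n + 1) := by
  change (HahnSeries.single (-1) 1 * s).coeff n = _
  rw [HahnSeries.coeff_single_mul, one_mul, sub_neg_eq_add]

theorem bijective_smul_add_laurentX (α : k) {β : k} (hβ : β ≠ 0) :
    Function.Bijective fun s : LaurentSeries k => α • s + β • laurentX s := by
  have key : (fun s : LaurentSeries k => α • s + β • laurentX s) = fun s =>
      (HahnSeries.single 0 α + HahnSeries.single (-1) β : LaurentSeries k) * s := by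
    ext s n
    rw [add_mul, HahnSeries.coeff_add, HahnSeries.coeff_add, HahnSeries.coeff_single_mul,
      HahnSeries.coeff_single_mul, HahnSeries.coeff_smul, HahnSeries.coeff_smul, laurentX_coeff]
    simp
  rw [key]
  have hne : (HahnSeries.single 0 α + HahnSeries.single (-1) β : LaurentSeries k) ≠ 0 := by
    intro h
    have := congrArg (fun s : LaurentSeries k => s.coeff (-1)) h
    simp [HahnSeries.coeff_single_of_ne, hβ] at this
  exact mulLeft_bijective₀ _ hne

/-- At `q ≠ p` the map is multiplication by `α + β t⁻¹`, a nonzero element of the field of Laurent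
series. This one object can therefore be tested against for every `X`. -/
theorem invertibleOn_laurent (X : Set (OnePoint k)) (p : OnePoint k) :
    InvertibleOn X (testRep p (laurentX (k := k))) := by
  rw [invertibleOn_iff]
  intro q _
  by_cases hpq : p = q
  · rw [← hpq]
    exact (invertibleOn_iff _ _).1 (invertibleOn_singleton_testRep p laurentX) p rfl
  obtain ⟨α, β, hβ, huq⟩ := exists_uMap_eq hpq
  have : (uMap (testRep p (laurentX (k := k))) q : _ → _) ∘ ofMapsZero p LinearMap.id laurentX =
      ofMapsOne p LinearMap.id laurentX ∘ fun s : LaurentSeries k => α • s + β • laurentX s := by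
    ext s
    rw [huq]
    simp
  rw [← Function.Bijective.of_comp_iff _ (ofMapsZero p LinearMap.id laurentX).bijective, this]
  exact (LinearEquiv.bijective _).comp (bijective_smul_add_laurentX α hβ)

/-- The coefficients of a Laurent series in nonpositive degrees. -/
noncomputable def principalPart : LaurentSeries k →ₗ[k] (ℕ →₀ k) where
  toFun s := Finsupp.ofSupportFinite (fun n : ℕ => s.coeff (-(n : ℤ))) (by
    obtain ⟨N, hN⟩ : ∃ N : ℤ, ∀ i, i < N → s.coeff i = 0 :=
      ⟨s.order, fun i => HahnSeries.coeff_eq_zero_of_lt_order⟩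
    refine (Set.finite_le_nat N.natAbs).subset fun n hn => ?_
    by_contra h
    have h' : ¬ n ≤ N.natAbs := h
    exact hn (hN _ (by omega)))
  map_add' s t := by ext n; rfl
  map_smul' r s := by ext n; rfl

theorem principalPart_apply (s : LaurentSeries k) (n : ℕ) :
    principalPart s n = s.coeff (-(n : ℤ)) := rfl

theorem principalPart_single (n : ℕ) :
    principalPart (HahnSeries.single (-(n : ℤ)) (1 : k)) = Finsupp.single n 1 := by
  ext m
  rw [principalPart_apply, HahnSeries.coeff_single, Finsupp.single_apply]
  simp [eq_comm]

theorem principalPart_laurentX (s : LaurentSeries k) :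
    principalPart (laurentX s) =
      Finsupp.single 0 (s.coeff 1) + Finsupp.mapDomain Nat.succ (principalPart s) := by
  ext n
  rw [principalPart_apply, laurentX_coeff, Finsupp.add_apply]
  cases n with
  | zero =>
    rw [Finsupp.mapDomain_of_notMem_range]
    · simp
    · rintro ⟨i, hi⟩
      exact Nat.succ_ne_zero i hi
  | succ n =>
    rw [Finsupp.single_eq_of_ne (by simp), Finsupp.mapDomain_apply Nat.succ_injective, zero_add,
      principalPart_apply]
    congr 1
    push_cast
    ring

end Laurent

variable {X : Set (OnePoint k)}

/-- The sequence defines a morphism from the Laurent representation through `k((t)) / t k[[t]]`,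
sending `t⁻ⁿ` to `aₙ`; the condition `u a₀ = 0` handles the coefficient that `t⁻¹` moves from degree
one to degree zero. -/
theorem IsContramodule.eq_zero_of_recursion {C : QuiverRep k} (hC : IsContramodule X C)
    (p : OnePoint k) (a : ℕ → C.obj .zero) (h0 : uMap C p (a 0) = 0)
    (ha : ∀ n, wMap C p (a n) = uMap C p (a (n + 1))) (n : ℕ) : a n = 0 := by
  have := hC.hom_test (invertibleOn_laurent X p)
    (Finsupp.linearCombination k a ∘ₗ principalPart) (fun s => by
      rw [LinearMap.comp_apply, LinearMap.comp_apply, principalPart_laurentX, map_add, map_add,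
        Finsupp.linearCombination_single, map_smul, h0, smul_zero, zero_add]
      refine LinearMap.congr_fun (f := wMap C p ∘ₗ Finsupp.linearCombination k a)
        (g := uMap C p ∘ₗ Finsupp.linearCombination k a ∘ₗ Finsupp.lmapDomain k k Nat.succ) ?_ _
      ext n
      simp [Finsupp.lmapDomain_apply, Finsupp.mapDomain_single, ha])
  have h1 := LinearMap.congr_fun this (HahnSeries.single (-(n : ℤ)) 1)
  rw [LinearMap.comp_apply, principalPart_single] at h1
  simpa using h1

/-- A functional `l` vanishing on all the right-hand sides would give a morphism to the Laurent
representation, `m ↦ ∑ l(m in place n) tⁿ`, which must be zero. -/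
theorem IsComodule.exists_recursion {M : QuiverRep k} (hM : IsComodule X M)
    (p : OnePoint k) (y : ℕ →₀ M.obj .one) :
    ∃ m : ℕ →₀ M.obj .zero, ∀ n, y n = uMap M p (m n) - wMap M p (m (n + 1)) := by
  let d : (ℕ →₀ M.obj .zero) →ₗ[k] (ℕ →₀ M.obj .one) := Finsupp.mapRange.linearMap (uMap M p) -
    Finsupp.mapRange.linearMap (wMap M p) ∘ₗ Finsupp.lcomapDomain Nat.succ Nat.succ_injective
  have hd : ∀ m n, d m n = uMap M p (m n) - wMap M p (m (n + 1)) := fun m n => rfl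
  suffices h : LinearMap.range d = ⊤ by
    obtain ⟨m, rfl⟩ := LinearMap.range_eq_top.1 h y
    exact ⟨m, hd m⟩
  by_contra hne
  obtain ⟨l, hl0, hl⟩ := Submodule.exists_le_ker_of_lt_top _ (lt_top_iff_ne_top.2 hne)
  have hld : ∀ m, l (d m) = 0 := fun m => hl ⟨m, rfl⟩
  have hl_zero : ∀ x, l (Finsupp.single 0 (uMap M p x)) = 0 := fun x => by
    rw [← hld (Finsupp.single 0 x)]
    congr 1
    ext n
    rw [hd]
    cases n <;> simp
  have hl_succ : ∀ n x, l (Finsupp.single (n + 1) (uMap M p x)) =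
      l (Finsupp.single n (wMap M p x)) := fun n x => by
    rw [← sub_eq_zero, ← map_sub, ← hld (Finsupp.single (n + 1) x)]
    congr 1
    ext i
    rw [hd]
    by_cases h1 : n + 1 = i <;> by_cases h2 : n = i <;> simp [h1, h2]
  let b : M.obj .one →ₗ[k] LaurentSeries k :=
    { toFun := fun m => HahnSeries.ofPowerSeries ℤ k
        (PowerSeries.mk fun n => l (Finsupp.single n m))
      map_add' := fun m m' => by
        rw [← map_add]
        congr 1
        ext n
        simp
      map_smul' := fun r m => by
        ext n
        rw [RingHom.id_apply, HahnSeries.coeff_smul, PowerSeries.coeff_coe,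
          PowerSeries.coeff_coe]
        split_ifs
        · simp
        · simp [← Finsupp.smul_single] }
  have hb : ∀ m n, (b m).coeff n = if n < 0 then 0 else l (Finsupp.single n.natAbs m) :=
    fun m n => by
      change (HahnSeries.ofPowerSeries ℤ k _).coeff n = _
      rw [PowerSeries.coeff_coe, PowerSeries.coeff_mk]
  have hb0 := hM.hom_test (invertibleOn_laurent X p) b (fun m => by
    ext n
    rw [laurentX_coeff, hb, hb]
    -- Degree `-1` is where `t⁻¹` could create a polar term; it vanishes because `l` kills `u x` in
    -- place `0`.
    rcases lt_trichotomy n (-1) with hn | rfl | hn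
    · rw [if_pos (by omega), if_pos (by omega)]
    · simp [hl_zero]
    · obtain ⟨i, rfl⟩ : ∃ i : ℕ, n = i := ⟨n.toNat, by omega⟩
      rw [if_neg (by omega), if_neg (by omega), ← hl_succ]
      rfl)
  apply hl0
  ext n m
  have := congrArg (fun s => HahnSeries.coeff s (n : ℤ)) (LinearMap.congr_fun hb0 m)
  simp only [hb] at this
  rw [if_neg (by omega)] at this
  exact this

/-! ### Morphisms with cone invertible at a point -/

/-- The square formed by a morphism `φ` and the maps at `p` is bicartesian; equivalently, the map
at `p` of the cone of `φ` is an isomorphism. -/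
structure IsBicartAt (p : OnePoint k) {A B : QuiverRep k} (φ : A ⟶ B) : Prop where
  inj : ∀ a, uMap A p a = 0 → (φ.app .zero).hom a = 0 → a = 0
  lift : ∀ a' b, (φ.app .one).hom a' = uMap B p b →
    ∃ a, uMap A p a = a' ∧ (φ.app .zero).hom a = b
  span : ∀ b', ∃ a' b, b' = (φ.app .one).hom a' + uMap B p b

namespace IsBicartAt

variable {p : OnePoint k} {A B C : QuiverRep k}

theorem bijective_uMap_ker {φ : A ⟶ B} (h : IsBicartAt p φ) {K : QuiverRep k} {ι : K ⟶ A} [Mono ι]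
    (hι : ∀ j, Function.Exact (ι.app j).hom (φ.app j).hom) : Function.Bijective (uMap K p) := by
  have hinj := (mono_iff_app ι).1 inferInstance
  constructor
  · rw [injective_iff_map_eq_zero]
    intro x hx
    refine hinj .zero (Eq.trans (h.inj _ ?_ ((hι .zero).apply_apply_eq_zero x)) (map_zero _).symm)
    rw [← app_uMap, hx, map_zero]
  · intro y
    obtain ⟨a, ha, ha'⟩ := h.lift ((ι.app .one).hom y) 0
      (((hι .one).apply_apply_eq_zero y).trans (map_zero _).symm)
    obtain ⟨x, rfl⟩ := (hι .zero a).1 ha'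
    refine ⟨x, hinj .one ?_⟩
    rw [app_uMap, ha]

theorem bijective_uMap_coker {φ : A ⟶ B} (h : IsBicartAt p φ) {Q : QuiverRep k} {π : B ⟶ Q} [Epi π]
    (hπ : ∀ j, Function.Exact (φ.app j).hom (π.app j).hom) : Function.Bijective (uMap Q p) := by
  have hsurj := (epi_iff_app π).1 inferInstance
  constructor
  · rw [injective_iff_map_eq_zero]
    intro x hx
    obtain ⟨b, rfl⟩ := hsurj .zero x
    rw [← app_uMap] at hx
    obtain ⟨a', ha'⟩ := (hπ .one _).1 hx
    obtain ⟨a, -, rfl⟩ := h.lift a' b ha'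
    exact (hπ .zero).apply_apply_eq_zero a
  · intro y
    obtain ⟨b', rfl⟩ := hsurj .one y
    obtain ⟨a', b, rfl⟩ := h.span b'
    refine ⟨(π.app .zero).hom b, ?_⟩
    rw [← app_uMap, map_add, (hπ .one).apply_apply_eq_zero, zero_add]

/-- Together with `of_comp_right` and `comp`, this is two-out-of-three for bicartesian squares,
proved by diagram chase. -/
theorem of_comp_left {φ : A ⟶ B} {ψ : B ⟶ C} (hφ : IsBicartAt p φ) (h : IsBicartAt p (φ ≫ ψ)) :
    IsBicartAt p ψ where
  inj b hb hb' := by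
    obtain ⟨a, ha, rfl⟩ := hφ.lift 0 b (by rw [hb, map_zero])
    rw [h.inj a ha hb', map_zero]
  lift b' c hc := by
    obtain ⟨a', b, rfl⟩ := hφ.span b'
    have h1 : ((φ ≫ ψ).app .one).hom a' = uMap C p (c - (ψ.app .zero).hom b) := by
      rw [map_sub, ← hc, map_add, app_uMap, add_sub_cancel_right]
      rfl
    obtain ⟨a, rfl, ha⟩ := h.lift a' _ h1
    refine ⟨(φ.app .zero).hom a + b, ?_, ?_⟩
    · rw [map_add, app_uMap]
    · rw [map_add]
      exact eq_sub_iff_add_eq.1 ha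
  span c' := by
    obtain ⟨a', c, rfl⟩ := h.span c'
    exact ⟨(φ.app .one).hom a', c, rfl⟩

theorem of_comp_right {φ : A ⟶ B} {ψ : B ⟶ C} (hψ : IsBicartAt p ψ) (h : IsBicartAt p (φ ≫ ψ)) :
    IsBicartAt p φ where
  inj a ha ha' := h.inj a ha (by rw [comp_app_hom, ha', map_zero])
  lift a' b hb := by
    obtain ⟨a, ha, hab⟩ := h.lift a' ((ψ.app .zero).hom b) (by rw [comp_app_hom, hb, app_uMap])
    refine ⟨a, ha, ?_⟩
    rw [← sub_eq_zero]
    refine hψ.inj _ ?_ ?_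
    · rw [map_sub, ← app_uMap, ha, hb, sub_self]
    · rw [map_sub, ← hab, comp_app_hom, sub_self]
  span b' := by
    obtain ⟨a', c, hc⟩ := h.span ((ψ.app .one).hom b')
    obtain ⟨b, hb, -⟩ := hψ.lift (b' - (φ.app .one).hom a') c (by
      rw [map_sub, hc, comp_app_hom, add_sub_cancel_left])
    exact ⟨a', b, by rw [hb]; abel⟩

theorem of_isIso (φ : A ⟶ B) [IsIso φ] : IsBicartAt p φ := by
  have h0 := fun j => (mono_iff_app φ).1 inferInstance j
  have h1 := fun j => (epi_iff_app φ).1 inferInstance j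
  refine ⟨fun a _ ha => h0 .zero (ha.trans (map_zero _).symm), fun a' b hab => ?_, fun b' => ?_⟩
  · obtain ⟨a, rfl⟩ := h1 .zero b
    refine ⟨a, h0 .one ?_, rfl⟩
    rw [app_uMap, hab]
  · obtain ⟨a', rfl⟩ := h1 .one b'
    exact ⟨a', 0, by simp⟩

theorem comp {φ : A ⟶ B} {ψ : B ⟶ C} (hφ : IsBicartAt p φ) (hψ : IsBicartAt p ψ) :
    IsBicartAt p (φ ≫ ψ) where
  inj a ha ha' := by
    refine hφ.inj a ha (hψ.inj _ ?_ ha')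
    rw [← app_uMap, ha, map_zero]
  lift a' c hc := by
    obtain ⟨b, hb, rfl⟩ := hψ.lift _ c hc
    obtain ⟨a, rfl, rfl⟩ := hφ.lift a' b hb.symm
    exact ⟨a, rfl, rfl⟩
  span c' := by
    obtain ⟨b', c, rfl⟩ := hψ.span c'
    obtain ⟨a', b, rfl⟩ := hφ.span b'
    refine ⟨a', (ψ.app .zero).hom b + c, ?_⟩
    rw [map_add, map_add, app_uMap, comp_app_hom, add_assoc]

end IsBicartAt

section ofMapsHom

variable {A B : Type u} [AddCommGroup A] [Module k A] [AddCommGroup B] [Module k B]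

/-- A morphism out of `ofMaps p u w`. -/
def homOfMaps (p : OnePoint k) {u w : A →ₗ[k] B} {M : QuiverRep k} (a : A →ₗ[k] M.obj .zero)
    (b : B →ₗ[k] M.obj .one) (hu : ∀ x, b (u x) = uMap M p (a x))
    (hw : ∀ x, b (w x) = wMap M p (a x)) : ofMaps p u w ⟶ M :=
  homMk p (a ∘ₗ (ofMapsZero p u w).symm.toLinearMap) (b ∘ₗ (ofMapsOne p u w).symm.toLinearMap)
    (fun m => by
      obtain ⟨m, rfl⟩ := (ofMapsZero p u w).surjective m
      simp [hu])
    (fun m => by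
      obtain ⟨m, rfl⟩ := (ofMapsZero p u w).surjective m
      simp [hw])

@[simp]
theorem homOfMaps_zero (p : OnePoint k) {u w : A →ₗ[k] B} {M : QuiverRep k}
    (a : A →ₗ[k] M.obj .zero) (b : B →ₗ[k] M.obj .one) (hu hw) (x : A) :
    ((homOfMaps (u := u) (w := w) p a b hu hw).app .zero).hom (ofMapsZero p u w x) = a x := by
  simp [homOfMaps]

@[simp]
theorem homOfMaps_one (p : OnePoint k) {u w : A →ₗ[k] B} {M : QuiverRep k}
    (a : A →ₗ[k] M.obj .zero) (b : B →ₗ[k] M.obj .one) (hu hw) (x : B) :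
    ((homOfMaps (u := u) (w := w) p a b hu hw).app .one).hom (ofMapsOne p u w x) = b x := by
  simp [homOfMaps]

/-- A morphism into `ofMaps p u w`. -/
def homToMaps (p : OnePoint k) {u w : A →ₗ[k] B} {M : QuiverRep k} (a : M.obj .zero →ₗ[k] A)
    (b : M.obj .one →ₗ[k] B) (hu : ∀ x, b (uMap M p x) = u (a x))
    (hw : ∀ x, b (wMap M p x) = w (a x)) : M ⟶ ofMaps p u w :=
  homMk p ((ofMapsZero p u w).toLinearMap ∘ₗ a) ((ofMapsOne p u w).toLinearMap ∘ₗ b)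
    (fun m => by simp [hu]) (fun m => by simp [hw])

theorem isLocallyNilpotentAt_ofMaps (p : OnePoint k) {z : A →ₗ[k] A}
    (hz : ∀ m, ∃ n : ℕ, (z ^ n) m = 0) : IsLocallyNilpotentAt p (ofMaps p z LinearMap.id) := by
  rcases p with _ | c
  · exact ⟨Function.bijective_id, z, fun _ => rfl, hz⟩
  · refine ⟨Function.bijective_id, z, fun x => ?_, hz⟩
    exact (uMap_ofMaps (.some c) z LinearMap.id x).symm

theorem isSummableAt_ofMaps (p : OnePoint k) {z : A →ₗ[k] A}
    (hz : Function.Bijective (telescope z)) : IsSummableAt p (ofMaps p z LinearMap.id) := by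
  rcases p with _ | c
  · exact ⟨Function.bijective_id, z, fun _ => rfl, hz⟩
  · refine ⟨Function.bijective_id, z, fun x => ?_, hz⟩
    exact (uMap_ofMaps (.some c) z LinearMap.id x).symm

end ofMapsHom

/-! ### The local part of a comodule -/

section localPart

variable (M : QuiverRep k) (p : OnePoint k)

/-- The finite sequences `(mₙ)` with `u mₙ = w mₙ₊₁`. -/
def localPart : Submodule k (ℕ →₀ M.obj .zero) where
  carrier := {m | ∀ n, uMap M p (m n) = wMap M p (m (n + 1))}
  add_mem' ha hb n := by simp [ha n, hb n]
  zero_mem' n := by simp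
  smul_mem' r m hm n := by simp [hm n]

/-- The shift operator on `localPart`. -/
noncomputable def localPartShift : localPart M p →ₗ[k] localPart M p :=
  (Finsupp.lcomapDomain Nat.succ Nat.succ_injective).restrict fun _ hm n => hm (n + 1)

theorem localPartShift_apply (m : localPart M p) (n : ℕ) :
    (localPartShift M p m).1 n = m.1 (n + 1) := rfl

theorem localPartShift_pow_apply (i : ℕ) (m : localPart M p) (n : ℕ) :
    ((localPartShift M p ^ i) m).1 n = m.1 (n + i) := by
  induction i generalizing m with
  | zero => rfl
  | succ i ih =>
    rw [pow_succ, Module.End.mul_apply, ih, localPartShift_apply, add_assoc]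

/-- The canonical map from the local part. -/
noncomputable def localPartHom : ofMaps p (localPartShift M p) LinearMap.id ⟶ M :=
  homOfMaps p (Finsupp.lapply 0 ∘ₗ (localPart M p).subtype)
    (wMap M p ∘ₗ Finsupp.lapply 0 ∘ₗ (localPart M p).subtype) (fun m => (m.2 0).symm)
    (fun _ => rfl)

theorem localPartHom_zero (m : localPart M p) :
    ((localPartHom M p).app .zero).hom (ofMapsZero p _ _ m) = m.1 0 :=
  homOfMaps_zero p _ _ _ _ m

theorem localPartHom_one (m : localPart M p) :
    ((localPartHom M p).app .one).hom (ofMapsOne p _ _ m) = wMap M p (m.1 0) :=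
  homOfMaps_one p _ _ _ _ m

theorem isComodule_localPart :
    IsComodule {p} (ofMaps p (localPartShift M p) LinearMap.id) := by
  refine (isLocallyNilpotentAt_ofMaps p fun m => ?_).isComodule
  refine ⟨m.1.support.sup id + 1, ?_⟩
  ext n
  rw [localPartShift_pow_apply]
  by_contra h
  have := Finset.le_sup (f := id) (Finsupp.mem_support_iff.2 h)
  simp only [id] at this
  omega

variable {M}

theorem IsComodule.isBicartAt_localPartHom (hM : IsComodule X M) :
    IsBicartAt p (localPartHom M p) where
  inj a ha ha' := by
    obtain ⟨m, rfl⟩ := (ofMapsZero p (localPartShift M p) LinearMap.id).surjective a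
    rw [uMap_ofMaps, EmbeddingLike.map_eq_zero_iff] at ha
    rw [localPartHom_zero] at ha'
    rw [EmbeddingLike.map_eq_zero_iff]
    ext n
    cases n with
    | zero => exact ha'
    | succ n => exact DFunLike.congr_fun (congrArg Subtype.val ha) n
  lift a' b hab := by
    obtain ⟨m, rfl⟩ := (ofMapsOne p (localPartShift M p) LinearMap.id).surjective a'
    rw [localPartHom_one] at hab
    -- Prepending `b` to the sequence undoes the shift; the hypothesis `w m₀ = u b` is the new
    -- compatibility condition.
    let m' : ℕ →₀ M.obj .zero := Finsupp.single 0 b + m.1.mapDomain Nat.succ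
    have h0 : m' 0 = b := by
      rw [Finsupp.add_apply, Finsupp.mapDomain_of_notMem_range]
      · simp
      · rintro ⟨i, hi⟩
        exact Nat.succ_ne_zero i hi
    have hs : ∀ n, m' (n + 1) = m.1 n := fun n => by
      rw [Finsupp.add_apply, Finsupp.single_eq_of_ne (by simp),
        Finsupp.mapDomain_apply Nat.succ_injective, zero_add]
    refine ⟨ofMapsZero p _ _ ⟨m', fun n => ?_⟩, ?_, ?_⟩
    · cases n with
      | zero => rw [h0, hs, hab]
      | succ n => rw [hs, hs, m.2 n]
    · rw [uMap_ofMaps]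
      congr 1
      ext n
      exact hs n
    · rw [localPartHom_zero]
      exact h0
  span b' := by
    -- Here `b' = u m₀ - w m₁`, and the tail `(m₁, m₂, …)` lies in the local part because the
    -- right-hand side is zero in later places.
    obtain ⟨m, hm⟩ := hM.exists_recursion p (Finsupp.single 0 b')
    have h0 := hm 0
    rw [Finsupp.single_eq_same] at h0
    refine ⟨ofMapsOne p _ _ ⟨-Finsupp.comapDomain Nat.succ m Nat.succ_injective.injOn,
      fun n => ?_⟩, m 0, ?_⟩
    · have hn := hm (n + 1)
      rw [Finsupp.single_eq_of_ne (by simp), eq_comm, sub_eq_zero] at hn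
      simpa using hn
    · rw [localPartHom_one]
      refine h0.trans ?_
      change _ = wMap M p (-m 1) + _
      rw [map_neg]
      abel

end localPart

/-! ### The completion of a contramodule -/

section powerSeries

variable {A : Type*} [AddCommGroup A] [Module k A]

/-- Multiplication by the variable on power series with coefficients in `A`. -/
def rightShift : (ℕ → A) →ₗ[k] (ℕ → A) where
  toFun c n := Nat.casesOn n 0 c
  map_add' c c' := by ext n; cases n <;> simp
  map_smul' r c := by ext n; cases n <;> simp

@[simp]
theorem rightShift_zero (c : ℕ → A) : rightShift (k := k) c 0 = 0 := rfl

@[simp]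
theorem rightShift_succ (c : ℕ → A) (n : ℕ) : rightShift (k := k) c (n + 1) = c n := rfl

theorem eq_zero_of_eq_rightShift {c : ℕ → ℕ → A} (hc : ∀ n, c n = rightShift (k := k) (c (n + 1)))
    (n : ℕ) : c n = 0 := by
  ext j
  induction j generalizing n with
  | zero => rw [hc]; rfl
  | succ j ih => rw [hc]; exact ih (n + 1)

/-- The sum of the power series `zⁱ cᵢ`. -/
def diagonalSum (c : ℕ → ℕ → A) (n : ℕ) : A :=
  ∑ ij ∈ Finset.HasAntidiagonal.antidiagonal n, c ij.1 ij.2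

theorem diagonalSum_eq (c : ℕ → ℕ → A) :
    diagonalSum c = c 0 + rightShift (k := k) (diagonalSum fun n => c (n + 1)) := by
  ext n
  cases n with
  | zero => simp [diagonalSum]
  | succ n => exact Finset.Nat.sum_antidiagonal_succ

end powerSeries

section completion

variable (C : QuiverRep k) (p : OnePoint k)

/-- The map `u - z w` on power series. -/
def pencilSeries : (ℕ → C.obj .zero) →ₗ[k] (ℕ → C.obj .one) :=
  LinearMap.compLeft (uMap C p) ℕ - rightShift ∘ₗ LinearMap.compLeft (wMap C p) ℕ

theorem pencilSeries_zero (a : ℕ → C.obj .zero) : pencilSeries C p a 0 = uMap C p (a 0) := by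
  simp [pencilSeries]

theorem pencilSeries_succ (a : ℕ → C.obj .zero) (n : ℕ) :
    pencilSeries C p a (n + 1) = uMap C p (a (n + 1)) - wMap C p (a n) := by
  simp [pencilSeries]

theorem pencilSeries_rightShift (a : ℕ → C.obj .zero) :
    pencilSeries C p (rightShift (k := k) a) = rightShift (k := k) (pencilSeries C p a) := by
  ext n
  rcases n with _ | _ | n
  · simp [pencilSeries_zero]
  · simp [pencilSeries_zero, pencilSeries_succ]
  · simp [pencilSeries_succ]

/-- The completion of `C` at `p`. -/
abbrev Completion : Type u := (ℕ → C.obj .one) ⧸ LinearMap.range (pencilSeries C p)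

/-- The operator `z` on the completion. -/
def completionShift : Completion C p →ₗ[k] Completion C p :=
  Submodule.mapQ _ _ rightShift (by
    rintro _ ⟨a, rfl⟩
    exact ⟨rightShift (k := k) a, pencilSeries_rightShift C p a⟩)

theorem completionShift_mk (c : ℕ → C.obj .one) :
    completionShift C p (Submodule.Quotient.mk c) = Submodule.Quotient.mk (rightShift (k := k) c) :=
  rfl

theorem mk_completion_eq_iff (c c' : ℕ → C.obj .one) :
    (Submodule.Quotient.mk c : Completion C p) = Submodule.Quotient.mk c' ↔
      ∃ a, pencilSeries C p a = c - c' := by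
  rw [Submodule.Quotient.eq]
  rfl

/-- On power series infinite sums `∑ zⁱ cᵢ` exist as `diagonalSum`, and `cₙ = z cₙ₊₁` for all `n`
forces `c = 0`. The quotient inherits both because the submodule is the image of a map that commutes
with `z` and such sums. -/
theorem bijective_telescope_completionShift :
    Function.Bijective (telescope (completionShift C p)) := by
  constructor
  · rw [injective_iff_map_eq_zero]
    intro a ha
    choose c hc using fun n => Submodule.Quotient.mk_surjective _ (a n)
    have h1 : ∀ n, ∃ b, pencilSeries C p b = c n - rightShift (k := k) (c (n + 1)) := fun n => by
      rw [← mk_completion_eq_iff, hc, ← completionShift_mk, hc]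
      exact sub_eq_zero.1 (congrFun ha n)
    choose b hb using h1
    -- Subtracting the infinite sum of the error terms `zⁱ bᵢ₊ₙ` makes the recursion for the lifts
    -- exact.
    have h2 : ∀ n, c n - pencilSeries C p (diagonalSum fun i => b (i + n)) = 0 := by
      refine eq_zero_of_eq_rightShift (k := k) fun n => ?_
      rw [diagonalSum_eq (k := k), map_add, zero_add, hb, pencilSeries_rightShift, map_sub]
      simp only [add_assoc, add_comm 1 n]
      abel
    ext n
    rw [← hc n, Pi.zero_apply, Submodule.Quotient.mk_eq_zero]
    exact ⟨_, (sub_eq_zero.1 (h2 n)).symm⟩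
  · intro a
    choose c hc using fun n => Submodule.Quotient.mk_surjective _ (a n)
    refine ⟨fun n => Submodule.Quotient.mk (diagonalSum fun i => c (i + n)), ?_⟩
    ext n
    rw [telescope_apply, completionShift_mk, ← Submodule.Quotient.mk_sub,
      diagonalSum_eq (k := k) (fun i => c (i + n))]
    simp only [zero_add, add_assoc, add_comm 1 n, add_sub_cancel_right, hc]

theorem isContramodule_completion :
    IsContramodule {p} (ofMaps p (completionShift C p) LinearMap.id) :=
  (isSummableAt_ofMaps p (bijective_telescope_completionShift C p)).isContramodule

/-- The canonical map to the completion. -/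
def completionHom : C ⟶ ofMaps p (completionShift C p) LinearMap.id :=
  homToMaps p (Submodule.mkQ _ ∘ₗ LinearMap.single k _ 0 ∘ₗ wMap C p)
    (Submodule.mkQ _ ∘ₗ LinearMap.single k (fun _ => C.obj .one) 0)
    (fun x => by
      refine (mk_completion_eq_iff C p _ _).2 ⟨Pi.single 0 x, ?_⟩
      ext n
      rcases n with _ | _ | n
      · simp [pencilSeries_zero]
      · simp [pencilSeries_succ]
      · simp [pencilSeries_succ])
    (fun _ => rfl)

theorem completionHom_zero (x : C.obj .zero) :
    ((completionHom C p).app .zero).hom x =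
      ofMapsZero p _ _ (Submodule.Quotient.mk (Pi.single 0 (wMap C p x))) := rfl

theorem completionHom_one (x : C.obj .one) :
    ((completionHom C p).app .one).hom x =
      ofMapsOne p _ _ (Submodule.Quotient.mk (Pi.single 0 x)) := rfl

variable {C}

theorem IsContramodule.isBicartAt_completionHom (hC : IsContramodule X C) :
    IsBicartAt p (completionHom C p) where
  inj a ha ha' := by
    rw [completionHom_zero, EmbeddingLike.map_eq_zero_iff] at ha'
    obtain ⟨s, hs⟩ := (Submodule.Quotient.mk_eq_zero _).1 ha'
    -- If `s` witnesses that the constant `w a` dies in the completion, then `w a = u s₀` and `w sₙ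
    -- = u sₙ₊₁`, so `(a, s₀, s₁, …)` satisfies the recursion.
    refine hC.eq_zero_of_recursion p (fun n => Nat.casesOn n a s) ha (fun n => ?_) 0
    have h := congrFun hs n
    cases n with
    | zero => rw [pencilSeries_zero] at h; simpa using h.symm
    | succ n =>
      rw [pencilSeries_succ] at h
      exact (sub_eq_zero.1 (h.trans (by simp))).symm
  lift a' b hab := by
    obtain ⟨b, rfl⟩ := (ofMapsZero p (completionShift C p) LinearMap.id).surjective b
    obtain ⟨c, rfl⟩ := Submodule.Quotient.mk_surjective _ b
    rw [completionHom_one, uMap_ofMaps] at hab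
    obtain ⟨s, hs⟩ := (mk_completion_eq_iff C p _ _).1
      ((ofMapsOne p (completionShift C p) LinearMap.id).injective hab)
    refine ⟨s 0, ?_, ?_⟩
    · have h := congrFun hs 0
      rw [pencilSeries_zero] at h
      simpa using h
    · rw [completionHom_zero]
      congr 1
      refine (mk_completion_eq_iff C p _ _).2 ⟨fun n => s (n + 1), ?_⟩
      ext n
      have h := congrFun hs (n + 1)
      rw [pencilSeries_succ, sub_eq_iff_eq_add] at h
      cases n with
      | zero =>
        rw [pencilSeries_zero, h]
        simp
        abel
      | succ n =>
        rw [pencilSeries_succ, h]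
        simp
  span b' := by
    obtain ⟨b, rfl⟩ := (ofMapsOne p (completionShift C p) LinearMap.id).surjective b'
    obtain ⟨c, rfl⟩ := Submodule.Quotient.mk_surjective _ b
    refine ⟨c 0, ofMapsZero p _ _ (Submodule.Quotient.mk fun n => c (n + 1)), ?_⟩
    rw [completionHom_one, uMap_ofMaps, ← map_add]
    congr 1
    rw [completionShift_mk]
    refine (congrArg Submodule.Quotient.mk ?_).trans (Submodule.Quotient.mk_add _)
    ext n
    cases n <;> simp

end completion

/-! ### Direct sums and products of representations -/

section sums

variable {ι : Type u} (M : ι → QuiverRep k)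

/-- The pointwise direct sum of a family of representations. -/
abbrev directSumRep : QuiverRep k :=
  ofPair (DFinsupp.mapRange.linearMap fun i => (fMap (M i)).hom)
    (DFinsupp.mapRange.linearMap fun i => (gMap (M i)).hom)

/-- The pointwise product of a family of representations. -/
abbrev piRep : QuiverRep k :=
  ofPair (LinearMap.pi fun i => (fMap (M i)).hom ∘ₗ LinearMap.proj i)
    (LinearMap.pi fun i => (gMap (M i)).hom ∘ₗ LinearMap.proj i)

theorem uMap_directSumRep (p : OnePoint k) (x : Π₀ i, (M i).obj .zero) (i : ι) :
    DFunLike.coe (F := Π₀ i, (M i).obj .one) (uMap (directSumRep M) p x) i = uMap (M i) p (x i) := by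
  rcases p with _ | c <;> rfl

theorem uMap_piRep (p : OnePoint k) (x : ∀ i, (M i).obj .zero) (i : ι) :
    (uMap (piRep M) p x : ∀ i, (M i).obj .one) i = uMap (M i) p (x i) := by
  rcases p with _ | c <;> rfl

open Classical in
/-- The inclusion of a summand at a vertex. -/
noncomputable abbrev directSumInclApp (j : WalkingParallelPair) (i : ι) :
    (M i).obj j →ₗ[k] Π₀ i, (M i).obj j :=
  DFinsupp.lsingle (R := k) (M := fun i => (M i).obj j) i

open Classical in
/-- The inclusion of a summand. -/
noncomputable def directSumIncl (i : ι) : M i ⟶ directSumRep M :=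
  homOfPair (W := directSumRep M) (directSumInclApp M .zero i) (directSumInclApp M .one i)
    (fun _ => (DFinsupp.mapRange_single (f := fun i => (fMap (M i)).hom)
      (hf := fun _ => map_zero _)).symm)
    (fun _ => (DFinsupp.mapRange_single (f := fun i => (gMap (M i)).hom)
      (hf := fun _ => map_zero _)).symm)

/-- The projection to a factor. -/
def piProj (i : ι) : piRep M ⟶ M i :=
  homOfPair (V := piRep M) (LinearMap.proj i : (∀ i, (M i).obj .zero) →ₗ[k] (M i).obj .zero)
    (LinearMap.proj i : (∀ i, (M i).obj .one) →ₗ[k] (M i).obj .one)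
    (fun _ => rfl) (fun _ => rfl)

open Classical in
/-- `directSumRep` is a coproduct. -/
noncomputable def directSumIsColimit : IsColimit (Cofan.mk _ (directSumIncl M)) :=
  Cofan.IsColimit.mk _
    (fun s => homOfPair
      (DFinsupp.lsum k (fun i => ((s.inj i).app .zero).hom) :
        (Π₀ i, (M i).obj .zero) →ₗ[k] s.pt.obj .zero)
      (DFinsupp.lsum k (fun i => ((s.inj i).app .one).hom) :
        (Π₀ i, (M i).obj .one) →ₗ[k] s.pt.obj .one)
      (fun x => by
        refine LinearMap.congr_fun (f := DFinsupp.lsum k (fun i => ((s.inj i).app .one).hom) ∘ₗ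
          DFinsupp.mapRange.linearMap fun i => (fMap (M i)).hom) (g := (fMap s.pt).hom ∘ₗ
          DFinsupp.lsum k (fun i => ((s.inj i).app .zero).hom)) ?_ x
        ext i y
        simp)
      (fun x => by
        refine LinearMap.congr_fun (f := DFinsupp.lsum k (fun i => ((s.inj i).app .one).hom) ∘ₗ
          DFinsupp.mapRange.linearMap fun i => (gMap (M i)).hom) (g := (gMap s.pt).hom ∘ₗ
          DFinsupp.lsum k (fun i => ((s.inj i).app .zero).hom)) ?_ x
        ext i y
        simp))
    (fun s i => hom_ext
      (fun x => DFinsupp.lsum_single k (fun i => ((s.inj i).app .zero).hom) i x)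
      (fun x => DFinsupp.lsum_single k (fun i => ((s.inj i).app .one).hom) i x))
    (fun s m hm => by
      refine hom_ext (LinearMap.congr_fun (f := (m.app .zero).hom) ?_)
        (LinearMap.congr_fun (f := (m.app .one).hom) ?_)
      · refine DFinsupp.lhom_ext' fun i => ?_
        ext x
        refine Eq.trans ?_ (DFinsupp.lsum_single k
          (fun i => ((s.inj i).app .zero).hom) i x).symm
        exact LinearMap.congr_fun (congrArg ModuleCat.Hom.hom (NatTrans.congr_app (hm i) .zero)) x
      · refine DFinsupp.lhom_ext' fun i => ?_
        ext x
        refine Eq.trans ?_ (DFinsupp.lsum_single k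
          (fun i => ((s.inj i).app .one).hom) i x).symm
        exact LinearMap.congr_fun (congrArg ModuleCat.Hom.hom (NatTrans.congr_app (hm i) .one)) x)

/-- `piRep` is a product. -/
def piIsLimit : IsLimit (Fan.mk _ (piProj M)) :=
  Fan.IsLimit.mk _
    (fun s => homOfPair
      (LinearMap.pi (fun i => ((s.proj i).app .zero).hom) :
        s.pt.obj .zero →ₗ[k] (∀ i, (M i).obj .zero))
      (LinearMap.pi (fun i => ((s.proj i).app .one).hom) :
        s.pt.obj .one →ₗ[k] (∀ i, (M i).obj .one))
      (fun x => funext fun i => app_uMap (s.proj i) .infty x)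
      (fun x => funext fun i => app_wMap (s.proj i) .infty x))
    (fun _ _ => hom_ext (fun _ => rfl) (fun _ => rfl))
    (fun _ _ hm => hom_ext
      (fun x => funext fun i =>
        LinearMap.congr_fun (congrArg ModuleCat.Hom.hom (NatTrans.congr_app (hm i) .zero)) x)
      (fun x => funext fun i =>
        LinearMap.congr_fun (congrArg ModuleCat.Hom.hom (NatTrans.congr_app (hm i) .one)) x))

variable {M}

open Classical in
-- The cokernel of the inclusion is the sum of the other summands, on which the map at `p` can be
-- inverted componentwise.
theorem isBicartAt_directSumIncl {p : OnePoint k} (i : ι)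
    (h : ∀ j, j ≠ i → Function.Bijective (uMap (M j) p)) : IsBicartAt p (directSumIncl M i) where
  inj a _ ha := DFinsupp.single_injective (β := fun i => (M i).obj .zero)
    (ha.trans (DFinsupp.single_zero i).symm)
  lift a' b hab := by
    let b₀ : Π₀ i, (M i).obj .zero := b
    have h1 : ∀ j, (DFinsupp.single i a' : Π₀ i, (M i).obj .one) j = uMap (M j) p (b₀ j) :=
      fun j => (DFunLike.congr_fun (F := Π₀ i, (M i).obj .one) hab j).trans (uMap_directSumRep M p b j)
    refine ⟨b₀ i, ?_, ?_⟩
    · rw [← h1, DFinsupp.single_eq_same]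
    · refine DFinsupp.ext (β := fun i => (M i).obj .zero)
        (f := DFinsupp.single i (b₀ i)) (g := b₀) fun j => ?_
      by_cases hj : j = i
      · subst hj
        rw [DFinsupp.single_eq_same]
      · rw [DFinsupp.single_eq_of_ne hj]
        refine ((h j hj).1 ?_).symm
        rw [← h1, DFinsupp.single_eq_of_ne hj, map_zero]
  span b' := by
    let e (j : ι) : (M j).obj .one →ₗ[k] (M j).obj .zero :=
      if hj : j = i then 0 else (LinearEquiv.ofBijective _ (h j hj)).symm.toLinearMap
    let c : Π₀ i, (M i).obj .one := b'
    refine ⟨c i, (DFinsupp.mapRange.linearMap e c : Π₀ i, (M i).obj .zero), ?_⟩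
    refine DFinsupp.ext (β := fun i => (M i).obj .one) fun j => ?_
    have h1 := uMap_directSumRep M p (DFinsupp.mapRange.linearMap e c) j
    refine Eq.trans ?_ (congrArg ((DFinsupp.single i (c i) : Π₀ i, (M i).obj .one) j + ·) h1.symm)
    rw [DFinsupp.mapRange.linearMap_apply, DFinsupp.mapRange_apply]
    by_cases hj : j = i
    · subst hj
      rw [DFinsupp.single_eq_same]
      simp [e, c]
    · rw [DFinsupp.single_eq_of_ne hj, zero_add]
      simp only [e, dif_neg hj]
      exact ((LinearEquiv.ofBijective _ (h j hj)).apply_symm_apply (c j)).symm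

open Classical in
theorem isBicartAt_piProj {p : OnePoint k} (i : ι)
    (h : ∀ j, j ≠ i → Function.Bijective (uMap (M j) p)) : IsBicartAt p (piProj M i) where
  inj a ha ha' := by
    let a₀ : ∀ i, (M i).obj .zero := a
    refine funext (f := a₀) (g := 0) fun j => ?_
    by_cases hj : j = i
    · subst hj
      exact ha'
    · refine (h j hj).1 ?_
      rw [← uMap_piRep M p a₀ j, Pi.zero_apply, map_zero]
      exact congrFun ha j
  lift a' b hab := by
    let c : ∀ i, (M i).obj .one := a'
    let a : ∀ i, (M i).obj .zero := fun j =>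
      if hj : j = i then hj ▸ b else (LinearEquiv.ofBijective _ (h j hj)).symm (c j)
    have hai : a i = b := by simp [a]
    refine ⟨a, funext fun j => ?_, hai⟩
    refine (uMap_piRep M p a j).trans ?_
    by_cases hj : j = i
    · subst hj
      rw [hai]
      exact hab.symm
    · simp only [a, dif_neg hj]
      exact (LinearEquiv.ofBijective _ (h j hj)).apply_symm_apply (c j)
  span b' := by
    refine ⟨(Pi.single i b' : ∀ i, (M i).obj .one), 0, ?_⟩
    rw [map_zero, add_zero]
    exact (Pi.single_eq_same (M := fun i => (M i).obj .one) i b').symm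

theorem isComodule_directSumRep (h : ∀ i, IsComodule X (M i)) :
    IsComodule X (directSumRep M) := by
  classical
  rw [isComodule_iff .infty]
  intro V hV
  constructor
  · intro φ
    refine Cofan.IsColimit.hom_ext (directSumIsColimit M) _ _ fun i => ?_
    rw [comp_zero]
    exact (h i V hV).1 _
  · intro φ ψ
    let φ' : (Π₀ i, (M i).obj .zero) →ₗ[k] V.obj .one := φ
    let ψ' : (Π₀ i, (M i).obj .zero) →ₗ[k] V.obj .one := ψ
    choose a b hab using fun i => ((isComodule_iff .infty X _).1 (h i) V hV).2
      (φ' ∘ₗ directSumInclApp M .zero i) (ψ' ∘ₗ directSumInclApp M .zero i)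
    refine ⟨DFinsupp.lsum k a, DFinsupp.lsum k b, fun x => ⟨?_, ?_⟩⟩
    · refine LinearMap.congr_fun (f := φ') (g := (fMap V).hom ∘ₗ DFinsupp.lsum k a -
        DFinsupp.lsum k b ∘ₗ DFinsupp.mapRange.linearMap fun i => (fMap (M i)).hom) ?_ x
      ext i y
      simp; exact (hab i y).1
    · refine LinearMap.congr_fun (f := ψ') (g := (gMap V).hom ∘ₗ DFinsupp.lsum k a -
        DFinsupp.lsum k b ∘ₗ DFinsupp.mapRange.linearMap fun i => (gMap (M i)).hom) ?_ x
      ext i y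
      simp; exact (hab i y).2

theorem isContramodule_piRep (h : ∀ i, IsContramodule X (M i)) :
    IsContramodule X (piRep M) := by
  rw [isContramodule_iff .infty]
  intro V hV
  constructor
  · intro φ
    refine Fan.IsLimit.hom_ext (piIsLimit M) _ _ fun i => ?_
    rw [zero_comp]
    exact (h i V hV).1 _
  · intro φ ψ
    let φ' : V.obj .zero →ₗ[k] (∀ i, (M i).obj .one) := φ
    let ψ' : V.obj .zero →ₗ[k] (∀ i, (M i).obj .one) := ψ
    choose a b hab using fun i => ((isContramodule_iff .infty X _).1 (h i) V hV).2
      (LinearMap.proj i ∘ₗ φ') (LinearMap.proj i ∘ₗ ψ')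
    exact ⟨LinearMap.pi a, LinearMap.pi b, fun x =>
      ⟨funext fun i => (hab i x).1, funext fun i => (hab i x).2⟩⟩

end sums

/-! ### Decompositions -/

section decompositions

theorem IsComodule.of_iso {M N : QuiverRep k} (e : M ≅ N) (hM : IsComodule X M) :
    IsComodule X N := by
  intro V hV
  refine ⟨fun h => ?_, fun x => ?_⟩
  · rw [← e.inv_hom_id_assoc h, (hM V hV).1 (e.hom ≫ h), comp_zero]
  · have h1 := (hM V hV).2 ((Abelian.Ext.mk₀ e.hom).comp x (zero_add 1))
    have h2 := congrArg (fun y => (Abelian.Ext.mk₀ e.inv).comp y (zero_add 1)) h1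
    simpa using h2

theorem IsContramodule.of_iso {M N : QuiverRep k} (e : M ≅ N) (hM : IsContramodule X M) :
    IsContramodule X N := by
  intro V hV
  refine ⟨fun h => ?_, fun x => ?_⟩
  · rw [← Category.comp_id h, ← e.inv_hom_id, ← Category.assoc, (hM V hV).1 (h ≫ e.inv), zero_comp]
  · have h1 := (hM V hV).2 (x.comp (Abelian.Ext.mk₀ e.inv) (add_zero 1))
    have h2 := congrArg (fun y => y.comp (Abelian.Ext.mk₀ e.hom) (add_zero 1)) h1
    simpa using h2

/-- Enlarging the set of points shrinks the class of representations to test. -/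
theorem IsComodule.mono {Y : Set (OnePoint k)} (h : X ⊆ Y) {M : QuiverRep k}
    (hM : IsComodule X M) : IsComodule Y M :=
  fun V hV => hM V fun p hp => hV p (h hp)

theorem IsContramodule.mono {Y : Set (OnePoint k)} (h : X ⊆ Y) {M : QuiverRep k}
    (hM : IsContramodule X M) : IsContramodule Y M :=
  fun V hV => hM V fun p hp => hV p (h hp)

theorem exact_kernel_app {A B : QuiverRep k} (φ : A ⟶ B) (j : WalkingParallelPair) :
    Function.Exact ((kernel.ι φ).app j).hom (φ.app j).hom :=
  (exact_iff_app (ShortComplex.mk (kernel.ι φ) φ (kernel.condition φ))).1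
    (ShortComplex.exact_of_f_is_kernel _ (kernelIsKernel φ)) j

theorem exact_cokernel_app {A B : QuiverRep k} (φ : A ⟶ B) (j : WalkingParallelPair) :
    Function.Exact (φ.app j).hom ((cokernel.π φ).app j).hom :=
  (exact_iff_app (ShortComplex.mk φ (cokernel.π φ) (cokernel.condition φ))).1
    (ShortComplex.exact_of_g_is_cokernel _ (cokernelIsCokernel φ)) j

theorem invertibleOn_kernel {A B : QuiverRep k} {φ : A ⟶ B} (h : ∀ p ∈ X, IsBicartAt p φ) :
    InvertibleOn X (kernel φ) := by
  rw [invertibleOn_iff]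
  exact fun p hp => (h p hp).bijective_uMap_ker (exact_kernel_app φ)

theorem invertibleOn_cokernel {A B : QuiverRep k} {φ : A ⟶ B} (h : ∀ p ∈ X, IsBicartAt p φ) :
    InvertibleOn X (cokernel φ) := by
  rw [invertibleOn_iff]
  exact fun p hp => (h p hp).bijective_uMap_coker (exact_cokernel_app φ)

/-- The cokernel is in `𝒱_X`, so `M` maps to it by zero and `φ` is epi. The kernel `K` is in `𝒱_X`
too, so `Ext¹(M, K) = 0` splits it off `P`, while `Hom(P, K) = 0` makes the retraction zero; hence
`K = 0`. -/
theorem IsComodule.isIso_of_isBicartAt {P M : QuiverRep k} (hP : IsComodule X P)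
    (hM : IsComodule X M) (φ : P ⟶ M) (h : ∀ p ∈ X, IsBicartAt p φ) : IsIso φ := by
  have hepi : Epi φ := Preadditive.epi_of_cokernel_zero ((hM _ (invertibleOn_cokernel h)).1 _)
  have hK := invertibleOn_kernel h
  let S : ShortComplex (QuiverRep k) := ShortComplex.mk (kernel.ι φ) φ (kernel.condition φ)
  have hS : S.ShortExact := { exact := ShortComplex.exact_of_f_is_kernel _ (kernelIsKernel φ) }
  obtain ⟨x, hx⟩ := Abelian.Ext.contravariant_sequence_exact₁ hS (kernel φ)
    (Abelian.Ext.mk₀ (𝟙 _)) (add_zero 1) ((hM _ hK).2 _)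
  obtain ⟨r, rfl⟩ := (Abelian.Ext.mk₀_bijective _ _).2 x
  rw [Abelian.Ext.mk₀_comp_mk₀] at hx
  have hr : kernel.ι φ ≫ r = 𝟙 _ := (Abelian.Ext.mk₀_bijective _ _).1 hx
  rw [(hP _ hK).1 r, comp_zero] at hr
  have hmono : Mono φ := Preadditive.mono_of_kernel_zero (by
    rw [← Category.id_comp (kernel.ι φ), ← hr, zero_comp])
  exact isIso_of_mono_of_epi φ

theorem IsContramodule.isIso_of_isBicartAt {C P : QuiverRep k} (hC : IsContramodule X C)
    (hP : IsContramodule X P) (φ : C ⟶ P) (h : ∀ p ∈ X, IsBicartAt p φ) : IsIso φ := by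
  have hmono : Mono φ := Preadditive.mono_of_kernel_zero ((hC _ (invertibleOn_kernel h)).1 _)
  have hQ := invertibleOn_cokernel h
  let S : ShortComplex (QuiverRep k) := ShortComplex.mk φ (cokernel.π φ) (cokernel.condition φ)
  have hS : S.ShortExact := { exact := ShortComplex.exact_of_g_is_cokernel _ (cokernelIsCokernel φ) }
  obtain ⟨x, hx⟩ := Abelian.Ext.covariant_sequence_exact₃ (cokernel φ) hS
    (Abelian.Ext.mk₀ (𝟙 _)) (zero_add 1) ((hC _ hQ).2 _)
  obtain ⟨r, rfl⟩ := (Abelian.Ext.mk₀_bijective _ _).2 x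
  rw [Abelian.Ext.mk₀_comp_mk₀] at hx
  have hr : r ≫ cokernel.π φ = 𝟙 _ := (Abelian.Ext.mk₀_bijective _ _).1 hx
  rw [(hP _ hQ).1 r, zero_comp] at hr
  have hepi : Epi φ := Preadditive.epi_of_cokernel_zero (by
    rw [← Category.comp_id (cokernel.π φ), ← hr, comp_zero])
  exact isIso_of_mono_of_epi φ

theorem bijective_uMap_of_isComodule {p q : OnePoint k} (hpq : p ≠ q) {M : QuiverRep k}
    (hM : IsComodule {p} M) : Function.Bijective (uMap M q) :=
  (isComodule_singleton_iff.1 hM).bijective_uMap hpq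

theorem bijective_uMap_of_isContramodule {p q : OnePoint k} (hpq : p ≠ q) {M : QuiverRep k}
    (hM : IsContramodule {p} M) : Function.Bijective (uMap M q) :=
  (isContramodule_singleton_iff.1 hM).bijective_uMap hpq

theorem isBicartAt_directSumIncl_of_isComodule {N : X → QuiverRep k}
    (hN : ∀ p : X, IsComodule {p.1} (N p)) (p : X) : IsBicartAt p.1 (directSumIncl N p) :=
  isBicartAt_directSumIncl p fun q hq =>
    bijective_uMap_of_isComodule (fun h => hq (Subtype.ext h)) (hN q)

theorem isBicartAt_piProj_of_isContramodule {N : X → QuiverRep k}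
    (hN : ∀ p : X, IsContramodule {p.1} (N p)) (p : X) : IsBicartAt p.1 (piProj N p) :=
  isBicartAt_piProj p fun q hq =>
    bijective_uMap_of_isContramodule (fun h => hq (Subtype.ext h)) (hN q)

theorem IsComodule.nonempty_sumDecomposition {M : QuiverRep k} (hM : IsComodule X M) :
    Nonempty (SumDecomposition X M) := by
  let N (p : X) : QuiverRep k := ofMaps p.1 (localPartShift M p.1) LinearMap.id
  have hN : ∀ p : X, IsComodule {p.1} (N p) := fun p => isComodule_localPart M p.1
  let t := Cofan.mk M fun p : X => localPartHom M p.1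
  let φ : directSumRep N ⟶ M := (directSumIsColimit N).desc t
  have hφ : ∀ p : X, directSumIncl N p ≫ φ = localPartHom M p.1 :=
    fun p => (directSumIsColimit N).fac t ⟨p⟩
  have hb : ∀ p ∈ X, IsBicartAt p φ := fun p hp =>
    -- The `p`-th inclusion and its composite with `φ` are both bicartesian at `p`, hence so is `φ`.
    (isBicartAt_directSumIncl_of_isComodule hN ⟨p, hp⟩).of_comp_left (by
      rw [hφ]
      exact hM.isBicartAt_localPartHom p)
  have hP : IsComodule X (directSumRep N) :=
    isComodule_directSumRep fun p => (hN p).mono (Set.singleton_subset_iff.2 p.2)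
  have : IsIso φ := hP.isIso_of_isBicartAt hM φ hb
  exact ⟨⟨N, hN, _, (directSumIsColimit N).ofPointIso (t := t) (i := this)⟩⟩

theorem IsContramodule.nonempty_prodDecomposition {C : QuiverRep k} (hC : IsContramodule X C) :
    Nonempty (ProdDecomposition X C) := by
  let N (p : X) : QuiverRep k := ofMaps p.1 (completionShift C p.1) LinearMap.id
  have hN : ∀ p : X, IsContramodule {p.1} (N p) := fun p => isContramodule_completion C p.1
  let t := Fan.mk C fun p : X => completionHom C p.1
  let φ : C ⟶ piRep N := (piIsLimit N).lift t
  have hφ : ∀ p : X, φ ≫ piProj N p = completionHom C p.1 :=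
    fun p => (piIsLimit N).fac t ⟨p⟩
  have hb : ∀ p ∈ X, IsBicartAt p φ := fun p hp =>
    (isBicartAt_piProj_of_isContramodule hN ⟨p, hp⟩).of_comp_right (by
      rw [hφ]
      exact hC.isBicartAt_completionHom p)
  have hP : IsContramodule X (piRep N) :=
    isContramodule_piRep fun p => (hN p).mono (Set.singleton_subset_iff.2 p.2)
  have : IsIso φ := hC.isIso_of_isBicartAt hP φ hb
  exact ⟨⟨N, hN, _, (piIsLimit N).ofPointIso (t := t) (i := this)⟩⟩

namespace SumDecomposition

variable {M N : QuiverRep k} (D : SumDecomposition X M) (E : SumDecomposition X N)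

/-- The comparison with the pointwise direct sum. -/
noncomputable def isoDirectSum : directSumRep D.component ≅ M :=
  (directSumIsColimit D.component).coconePointUniqueUpToIso D.isColimit

theorem directSumIncl_isoDirectSum (p : X) :
    directSumIncl D.component p ≫ D.isoDirectSum.hom = D.incl p :=
  (directSumIsColimit D.component).comp_coconePointUniqueUpToIso_hom D.isColimit ⟨p⟩

theorem isComodule_total (D : SumDecomposition X M) : IsComodule X M :=
  (isComodule_directSumRep fun p =>
    (D.isComodule p).mono (Set.singleton_subset_iff.2 p.2)).of_iso D.isoDirectSum

theorem isBicartAt_incl (p : X) : IsBicartAt p.1 (D.incl p) := by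
  rw [← D.directSumIncl_isoDirectSum]
  exact (isBicartAt_directSumIncl_of_isComodule D.isComodule p).comp (.of_isIso _)

instance mono_incl (p : X) : Mono (D.incl p) := by
  classical
  have : D.incl p ≫ Cofan.IsColimit.desc D.isColimit
      (fun q => if h : q = p then eqToHom (by rw [h]) else 0) = 𝟙 _ := by
    refine (Cofan.IsColimit.fac D.isColimit _ p).trans ?_
    simp
  exact mono_of_mono_fac this

/-- The cokernel of `E.incl p` is invertible at `p`, so the `{p}`-comodule `D.component p` maps to
it by zero and its map to `N` factors through the monomorphism `E.incl p`. -/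
theorem existsUnique_hom (φ : M ⟶ N) :
    ∃! ψ : ∀ p : X, D.component p ⟶ E.component p, ∀ p, D.incl p ≫ φ = ψ p ≫ E.incl p := by
  have h : ∀ p, (D.incl p ≫ φ) ≫ cokernel.π (E.incl p) = 0 := fun p =>
    (D.isComodule p _ (invertibleOn_cokernel (by
      intro q hq
      rw [Set.mem_singleton_iff.1 hq]
      exact E.isBicartAt_incl p))).1 _
  refine ⟨fun p => Abelian.monoLift (E.incl p) _ (h p), fun p => ?_, fun ψ hψ => ?_⟩
  · exact (Abelian.monoLift_comp _ _ _).symm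
  · ext1 p
    rw [← cancel_mono (E.incl p), ← hψ, Abelian.monoLift_comp]

theorem existsUnique_iso (E : SumDecomposition X M) :
    ∃! ψ : ∀ p : X, D.component p ≅ E.component p, ∀ p, (ψ p).hom ≫ E.incl p = D.incl p := by
  obtain ⟨a, ha, -⟩ := D.existsUnique_hom E (𝟙 M)
  obtain ⟨b, hb, -⟩ := E.existsUnique_hom D (𝟙 M)
  simp only [Category.comp_id] at ha hb
  refine ⟨fun p => ⟨a p, b p, ?_, ?_⟩, fun p => (ha p).symm, fun ψ hψ => ?_⟩
  · rw [← cancel_mono (D.incl p), Category.assoc, ← hb, ← ha, Category.id_comp]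
  · rw [← cancel_mono (E.incl p), Category.assoc, ← ha, ← hb, Category.id_comp]
  · ext1 p
    apply Iso.ext
    rw [← cancel_mono (E.incl p), hψ, ← ha]

end SumDecomposition

namespace ProdDecomposition

variable {C B : QuiverRep k} (D : ProdDecomposition X C) (E : ProdDecomposition X B)

/-- The comparison with the pointwise product. -/
noncomputable def isoPi : C ≅ piRep D.component :=
  D.isLimit.conePointUniqueUpToIso (piIsLimit D.component)

theorem isoPi_piProj (p : X) : D.isoPi.hom ≫ piProj D.component p = D.proj p :=
  D.isLimit.conePointUniqueUpToIso_hom_comp (piIsLimit D.component) ⟨p⟩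

theorem isContramodule_total (D : ProdDecomposition X C) : IsContramodule X C :=
  (isContramodule_piRep fun p =>
    (D.isContramodule p).mono (Set.singleton_subset_iff.2 p.2)).of_iso D.isoPi.symm

theorem isBicartAt_proj (p : X) : IsBicartAt p.1 (D.proj p) := by
  rw [← D.isoPi_piProj]
  exact IsBicartAt.comp (.of_isIso _) (isBicartAt_piProj_of_isContramodule D.isContramodule p)

instance epi_proj (p : X) : Epi (D.proj p) := by
  classical
  have : Fan.IsLimit.lift D.isLimit
      (fun q => if h : q = p then eqToHom (by rw [h]) else 0) ≫ D.proj p = 𝟙 _ := by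
    refine (Fan.IsLimit.fac D.isLimit _ p).trans ?_
    simp
  exact epi_of_epi_fac this

theorem existsUnique_hom (φ : C ⟶ B) :
    ∃! ψ : ∀ p : X, D.component p ⟶ E.component p, ∀ p, φ ≫ E.proj p = D.proj p ≫ ψ p := by
  have h : ∀ p, kernel.ι (D.proj p) ≫ φ ≫ E.proj p = 0 := fun p =>
    (E.isContramodule p _ (invertibleOn_kernel (by
      intro q hq
      rw [Set.mem_singleton_iff.1 hq]
      exact D.isBicartAt_proj p))).1 _
  refine ⟨fun p => Abelian.epiDesc (D.proj p) _ (h p), fun p => ?_, fun ψ hψ => ?_⟩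
  · exact (Abelian.comp_epiDesc _ _ _).symm
  · ext1 p
    rw [← cancel_epi (D.proj p), ← hψ, Abelian.comp_epiDesc]

theorem existsUnique_iso (E : ProdDecomposition X C) :
    ∃! ψ : ∀ p : X, D.component p ≅ E.component p, ∀ p, D.proj p ≫ (ψ p).hom = E.proj p := by
  obtain ⟨a, ha, -⟩ := D.existsUnique_hom E (𝟙 C)
  obtain ⟨b, hb, -⟩ := E.existsUnique_hom D (𝟙 C)
  simp only [Category.id_comp] at ha hb
  refine ⟨fun p => ⟨a p, b p, ?_, ?_⟩, fun p => (ha p).symm, fun ψ hψ => ?_⟩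
  · rw [← cancel_epi (D.proj p), ← Category.assoc, ← ha, ← hb, Category.comp_id]
  · rw [← cancel_epi (E.proj p), ← Category.assoc, ← hb, ← ha, Category.comp_id]
  · ext1 p
    apply Iso.ext
    rw [← cancel_epi (D.proj p), hψ, ← ha]

end ProdDecomposition

/-! ### The direct sum and product functors -/

section functors

/-- The tautological decomposition of a direct sum. -/
noncomputable def sumFunctorDecomposition
    (N : ∀ p : X, (IsComodule ({p.1} : Set (OnePoint k))).FullSubcategory) :
    SumDecomposition X ((sumFunctor X).obj N) where
  component p := (N p).obj
  isComodule p := (N p).property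
  incl := Sigma.ι fun p => (N p).obj
  isColimit := coproductIsCoproduct _

/-- The tautological decomposition of a product. -/
noncomputable def prodFunctorDecomposition
    (N : ∀ p : X, (IsContramodule ({p.1} : Set (OnePoint k))).FullSubcategory) :
    ProdDecomposition X ((prodFunctor X).obj N) where
  component p := (N p).obj
  isContramodule p := (N p).property
  proj := Pi.π fun p => (N p).obj
  isLimit := productIsProduct _

theorem incl_sumFunctor_map {N N' : ∀ p : X, (IsComodule ({p.1} : Set (OnePoint k))).FullSubcategory}
    (φ : N ⟶ N') (p : X) : (sumFunctorDecomposition N).incl p ≫ (sumFunctor X).map φ =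
      (φ p).hom ≫ (sumFunctorDecomposition N').incl p :=
  Sigma.ι_map (fun p => (φ p).hom) p

theorem prodFunctor_map_proj
    {N N' : ∀ p : X, (IsContramodule ({p.1} : Set (OnePoint k))).FullSubcategory}
    (φ : N ⟶ N') (p : X) : (prodFunctor X).map φ ≫ (prodFunctorDecomposition N').proj p =
      (prodFunctorDecomposition N).proj p ≫ (φ p).hom :=
  Pi.map_π (fun p => (φ p).hom) p

variable (X)

instance : (sumFunctor X).Faithful where
  map_injective {N N'} φ φ' h := by
    ext1 p
    apply ObjectProperty.hom_ext
    refine ((sumFunctorDecomposition N').mono_incl p).right_cancellation _ _ ?_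
    exact (incl_sumFunctor_map φ p).symm.trans
      ((congrArg (_ ≫ ·) h).trans (incl_sumFunctor_map φ' p))

instance : (sumFunctor X).Full where
  map_surjective {N N'} φ := by
    obtain ⟨ψ, hψ, -⟩ := (sumFunctorDecomposition N).existsUnique_hom
      (sumFunctorDecomposition N') φ
    refine ⟨fun p => ObjectProperty.homMk (ψ p), ?_⟩
    refine Cofan.IsColimit.hom_ext (sumFunctorDecomposition N).isColimit _ _ fun p => ?_
    exact (incl_sumFunctor_map _ p).trans (hψ p).symm

instance : (prodFunctor X).Faithful where
  map_injective {N N'} φ φ' h := by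
    ext1 p
    apply ObjectProperty.hom_ext
    refine ((prodFunctorDecomposition N).epi_proj p).left_cancellation _ _ ?_
    exact (prodFunctor_map_proj φ p).symm.trans
      ((congrArg (· ≫ _) h).trans (prodFunctor_map_proj φ' p))

instance : (prodFunctor X).Full where
  map_surjective {N N'} φ := by
    obtain ⟨ψ, hψ, -⟩ := (prodFunctorDecomposition N).existsUnique_hom
      (prodFunctorDecomposition N') φ
    refine ⟨fun p => ObjectProperty.homMk (ψ p), ?_⟩
    refine Fan.IsLimit.hom_ext (prodFunctorDecomposition N').isLimit _ _ fun p => ?_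
    exact (prodFunctor_map_proj _ p).trans (hψ p).symm

/-- The direct sum functor to `X`-comodules. -/
noncomputable def sumLift :
    (∀ p : X, (IsComodule ({p.1} : Set (OnePoint k))).FullSubcategory) ⥤
      (IsComodule X).FullSubcategory :=
  (IsComodule X).lift (sumFunctor X) fun N => (sumFunctorDecomposition N).isComodule_total

/-- The product functor to `X`-contramodules. -/
noncomputable def prodLift :
    (∀ p : X, (IsContramodule ({p.1} : Set (OnePoint k))).FullSubcategory) ⥤
      (IsContramodule X).FullSubcategory :=
  (IsContramodule X).lift (prodFunctor X) fun N => (prodFunctorDecomposition N).isContramodule_total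

instance : (sumLift X).Faithful := inferInstanceAs ((IsComodule X).lift _ _).Faithful

instance : (sumLift X).Full := inferInstanceAs ((IsComodule X).lift _ _).Full

instance : (prodLift X).Faithful := inferInstanceAs ((IsContramodule X).lift _ _).Faithful

instance : (prodLift X).Full := inferInstanceAs ((IsContramodule X).lift _ _).Full

instance : (sumLift X).EssSurj where
  mem_essImage M := by
    obtain ⟨D⟩ := IsComodule.nonempty_sumDecomposition M.property
    let N (p : X) : (IsComodule ({p.1} : Set (OnePoint k))).FullSubcategory :=
      ⟨D.component p, D.isComodule p⟩
    let e : (sumFunctor X).obj N ≅ M.obj :=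
      (sumFunctorDecomposition N).isColimit.coconePointUniqueUpToIso D.isColimit
    exact ⟨N, ⟨ObjectProperty.isoMk _ e⟩⟩

instance : (prodLift X).EssSurj where
  mem_essImage M := by
    obtain ⟨D⟩ := IsContramodule.nonempty_prodDecomposition M.property
    let N (p : X) : (IsContramodule ({p.1} : Set (OnePoint k))).FullSubcategory :=
      ⟨D.component p, D.isContramodule p⟩
    let e : (prodFunctor X).obj N ≅ M.obj :=
      (prodFunctorDecomposition N).isLimit.conePointUniqueUpToIso D.isLimit
    exact ⟨N, ⟨ObjectProperty.isoMk _ e⟩⟩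

instance : (sumLift X).IsEquivalence where

instance : (prodLift X).IsEquivalence where

end functors

end decompositions

/-! ### Equivalences for one point -/

section ofMapsMap

variable {A B : Type u} [AddCommGroup A] [Module k A] [AddCommGroup B] [Module k B]
  {z : A →ₗ[k] A} {z' : B →ₗ[k] B}

/-- The morphism of representations induced by a linear map commuting with the operators. -/
def ofMapsMap (p : OnePoint k) (φ : A →ₗ[k] B) (hφ : ∀ v, φ (z v) = z' (φ v)) :
    ofMaps p z LinearMap.id ⟶ ofMaps p z' LinearMap.id :=
  homOfMaps p ((ofMapsZero p z' LinearMap.id).toLinearMap ∘ₗ φ)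
    ((ofMapsOne p z' LinearMap.id).toLinearMap ∘ₗ φ) (fun v => by simp [hφ]) (fun v => by simp)

@[simp]
theorem ofMapsMap_zero (p : OnePoint k) (φ : A →ₗ[k] B) (hφ : ∀ v, φ (z v) = z' (φ v)) (x : A) :
    ((ofMapsMap p φ hφ).app .zero).hom (ofMapsZero p z LinearMap.id x) =
      ofMapsZero p z' LinearMap.id (φ x) :=
  homOfMaps_zero p _ _ _ _ x

@[simp]
theorem ofMapsMap_one (p : OnePoint k) (φ : A →ₗ[k] B) (hφ : ∀ v, φ (z v) = z' (φ v)) (x : A) :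
    ((ofMapsMap p φ hφ).app .one).hom (ofMapsOne p z LinearMap.id x) =
      ofMapsOne p z' LinearMap.id (φ x) :=
  homOfMaps_one p _ _ _ _ x

theorem ofMaps_hom_ext {p : OnePoint k} {u w : A →ₗ[k] B} {M : QuiverRep k}
    {φ ψ : ofMaps p u w ⟶ M}
    (h0 : ∀ x, (φ.app .zero).hom (ofMapsZero p u w x) = (ψ.app .zero).hom (ofMapsZero p u w x))
    (h1 : ∀ x, (φ.app .one).hom (ofMapsOne p u w x) = (ψ.app .one).hom (ofMapsOne p u w x)) :
    φ = ψ := by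
  refine hom_ext (fun x => ?_) (fun x => ?_)
  · obtain ⟨x, rfl⟩ := (ofMapsZero p u w).surjective x
    exact h0 x
  · obtain ⟨x, rfl⟩ := (ofMapsOne p u w).surjective x
    exact h1 x

theorem ofMapsMap_id (p : OnePoint k) (h : ∀ v, (LinearMap.id : A →ₗ[k] A) (z v) = z v) :
    ofMapsMap p LinearMap.id h = 𝟙 (ofMaps p z LinearMap.id) :=
  ofMaps_hom_ext (fun x => ofMapsMap_zero p _ _ x) (fun x => ofMapsMap_one p _ _ x)

theorem ofMapsMap_comp {C : Type u} [AddCommGroup C] [Module k C] {z'' : C →ₗ[k] C}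
    (p : OnePoint k) (φ : A →ₗ[k] B) (hφ : ∀ v, φ (z v) = z' (φ v)) (ψ : B →ₗ[k] C)
    (hψ : ∀ v, ψ (z' v) = z'' (ψ v)) (h : ∀ v, (ψ ∘ₗ φ) (z v) = z'' ((ψ ∘ₗ φ) v)) :
    ofMapsMap p (ψ ∘ₗ φ) h = ofMapsMap p φ hφ ≫ ofMapsMap p ψ hψ :=
  ofMaps_hom_ext (fun x => by simp) (fun x => by simp)

theorem ofMapsMap_injective {p : OnePoint k} {φ φ' : A →ₗ[k] B} (hφ : ∀ v, φ (z v) = z' (φ v))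
    (hφ' : ∀ v, φ' (z v) = z' (φ' v)) (h : ofMapsMap p φ hφ = ofMapsMap p φ' hφ') : φ = φ' := by
  ext x
  apply (ofMapsOne p z' LinearMap.id).injective
  rw [← ofMapsMap_one p φ hφ, ← ofMapsMap_one p φ' hφ', h]

/-- Since `w = id` on both sides, the two components of a morphism coincide, and compatibility with
`u` says that they commute with the operators. -/
theorem ofMapsMap_surjective {p : OnePoint k}
    (h : ofMaps p z LinearMap.id ⟶ ofMaps p z' LinearMap.id) :
    ∃ (φ : A →ₗ[k] B) (hφ : ∀ v, φ (z v) = z' (φ v)), ofMapsMap p φ hφ = h := by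
  let φ : A →ₗ[k] B := (ofMapsOne p z' LinearMap.id).symm.toLinearMap ∘ₗ (h.app .one).hom ∘ₗ
    (ofMapsOne p z LinearMap.id).toLinearMap
  have h1 : ∀ x, (h.app .one).hom (ofMapsOne p z LinearMap.id x) =
      ofMapsOne p z' LinearMap.id (φ x) := fun x => by simp [φ]
  have h0 : ∀ x, (h.app .zero).hom (ofMapsZero p z LinearMap.id x) =
      ofMapsZero p z' LinearMap.id (φ x) := fun x => by
    obtain ⟨y, hy⟩ := (ofMapsZero p z' LinearMap.id).surjective
      ((h.app .zero).hom (ofMapsZero p z LinearMap.id x))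
    have h2 := app_wMap h p (ofMapsZero p z LinearMap.id x)
    rw [← hy, wMap_ofMaps, wMap_ofMaps, LinearMap.id_apply, h1] at h2
    rw [← hy, (ofMapsOne p z' LinearMap.id).injective h2, LinearMap.id_apply]
  have hφ : ∀ v, φ (z v) = z' (φ v) := fun v => by
    have h2 := app_uMap h p (ofMapsZero p z LinearMap.id v)
    rw [h0, uMap_ofMaps, uMap_ofMaps, h1] at h2
    exact (ofMapsOne p z' LinearMap.id).injective h2
  refine ⟨φ, hφ, ofMaps_hom_ext (fun x => ?_) (fun x => ?_)⟩
  · rw [ofMapsMap_zero, h0]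
  · rw [ofMapsMap_one, h1]

theorem nonempty_iso_ofMaps {p : OnePoint k} {M : QuiverRep k}
    (hw : Function.Bijective (wMap M p)) {z : M.obj .one →ₗ[k] M.obj .one}
    (hz : ∀ x, z (wMap M p x) = uMap M p x) : Nonempty (ofMaps p z LinearMap.id ≅ M) := by
  let φ : M ⟶ ofMaps p z LinearMap.id :=
    homToMaps p (wMap M p) LinearMap.id (fun x => (hz x).symm) (fun _ => rfl)
  have hmono : Mono φ := by
    rw [mono_iff_app]
    rintro (_ | _)
    · exact (ofMapsZero p z LinearMap.id).injective.comp hw.1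
    · exact (ofMapsOne p z LinearMap.id).injective
  have hepi : Epi φ := by
    rw [epi_iff_app]
    rintro (_ | _)
    · exact (ofMapsZero p z LinearMap.id).surjective.comp hw.2
    · exact (ofMapsOne p z LinearMap.id).surjective
  have := isIso_of_mono_of_epi φ
  exact ⟨(asIso φ).symm⟩

end ofMapsMap

namespace NilpotentSpace

/-- The `{p}`-comodule given by a locally nilpotent operator. -/
def toComodule (p : OnePoint k) :
    NilpotentSpace k ⥤ (IsComodule ({p} : Set (OnePoint k))).FullSubcategory where
  obj V := ⟨ofMaps p V.z LinearMap.id,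
    (isLocallyNilpotentAt_ofMaps p V.locallyNilpotent).isComodule⟩
  map φ := ObjectProperty.homMk (ofMapsMap p φ.toLin φ.comm)
  map_id V := ObjectProperty.hom_ext _ (ofMapsMap_id (z := V.z) p fun _ => rfl)
  map_comp φ ψ := ObjectProperty.hom_ext _
    (ofMapsMap_comp p φ.toLin φ.comm ψ.toLin ψ.comm (φ ≫ ψ).comm)

instance (p : OnePoint k) : (toComodule p).Faithful where
  map_injective {_ _} φ ψ h :=
    Hom.ext (ofMapsMap_injective φ.comm ψ.comm (congrArg InducedCategory.Hom.hom h))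

instance (p : OnePoint k) : (toComodule p).Full where
  map_surjective h := by
    obtain ⟨φ, hφ, hh⟩ := ofMapsMap_surjective h.hom
    exact ⟨⟨φ, hφ⟩, ObjectProperty.hom_ext _ hh⟩

instance (p : OnePoint k) : (toComodule p).EssSurj where
  mem_essImage M := by
    obtain ⟨hw, z, hz, hn⟩ := isComodule_singleton_iff.1 M.property
    obtain ⟨e⟩ := nonempty_iso_ofMaps hw hz
    exact ⟨⟨M.obj.obj .one, z, hn⟩, ⟨ObjectProperty.isoMk _ e⟩⟩

instance (p : OnePoint k) : (toComodule p).IsEquivalence where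

end NilpotentSpace

/-! ### Infinite summation operations as operators with bijective `telescope`. -/

namespace SummationSpace

/-- The operator `c ↦ z c` of a space with infinite summation. -/
def shift (C : SummationSpace k) : C.carrier →ₗ[k] C.carrier :=
  C.sum ∘ₗ LinearMap.single k (fun _ : ℕ => C.carrier) 1

theorem shift_apply (C : SummationSpace k) (v : C.carrier) :
    C.shift v = C.sum (Pi.single 1 v) := rfl

theorem sum_single_zero (C : SummationSpace k) (v : C.carrier) :
    C.sum (Pi.single 0 v) = v := by
  rw [C.sum_unital, Pi.single_eq_same]
  intro n hn
  exact Pi.single_eq_of_ne (by omega) _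

theorem sum_eq (C : SummationSpace k) (c : ℕ → C.carrier) :
    C.sum c = c 0 + C.shift (C.sum fun n => c (n + 1)) := by
  -- Associativity for the rows `(c₀, 0, …)`, `(c₁, c₂, …)`, `0`, …: the antidiagonal sums are `cₙ`,
  -- and the row sums are `c₀`, `∑ zⁿ cₙ₊₁`, `0`, ….
  let d (i : ℕ) : ℕ → C.carrier :=
    match i with
    | 0 => Pi.single 0 (c 0)
    | 1 => fun n => c (n + 1)
    | _ + 2 => 0
  have h1 : (fun i => C.sum (d i)) = Pi.single 0 (c 0) +
      Pi.single 1 (C.sum fun n => c (n + 1)) := by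
    ext i
    rcases i with _ | _ | i
    · simp only [d, Pi.add_apply, Pi.single_eq_same]
      rw [sum_single_zero]
      simp
    · simp [d]
    · simp [d]
  have h2 : (fun n => ∑ ij ∈ Finset.HasAntidiagonal.antidiagonal n, d ij.1 ij.2) = c := by
    ext n
    rcases n with _ | n
    · simp [d]
    · rw [Finset.Nat.sum_antidiagonal_succ]
      cases n with
      | zero => simp [d]
      | succ n =>
        rw [Finset.Nat.sum_antidiagonal_succ]
        simp [d]
  have h := C.sum_assoc d
  rw [h1, h2, map_add, sum_single_zero] at h
  rw [← h, shift_apply]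

theorem bijective_telescope_shift (C : SummationSpace k) :
    Function.Bijective (telescope C.shift) := by
  constructor
  · rw [injective_iff_map_eq_zero]
    have key : ∀ a : ℕ → C.carrier, (∀ n, a n = C.shift (a (n + 1))) → a 0 = 0 := by
      intro a ha
      -- Row `i` is `(0, aᵢ₊₁, 0, …)` with sum `z aᵢ₊₁ = aᵢ`, while the antidiagonal sums are `0,
      -- a₁, a₂, …`. Associativity then reads `∑ zⁿ aₙ = ∑ zⁿ aₙ - a₀`.
      let d (i : ℕ) : ℕ → C.carrier := Pi.single 1 (a (i + 1))
      have h1 : (fun i => C.sum (d i)) = a := by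
        ext i
        exact (ha i).symm
      have h2 : (fun n => ∑ ij ∈ Finset.HasAntidiagonal.antidiagonal n, d ij.1 ij.2) =
          a - Pi.single 0 (a 0) := by
        ext n
        rcases n with _ | n
        · simp [d]
        · rw [Finset.Nat.sum_antidiagonal_succ']
          cases n with
          | zero => simp [d]
          | succ n =>
            rw [Finset.Nat.sum_antidiagonal_succ']
            simp [d]
      have h := C.sum_assoc d
      rw [h1, h2, map_sub, sum_single_zero] at h
      exact sub_eq_self.1 h.symm
    intro a ha
    ext n
    have := key (fun i => a (i + n)) fun i => by
      have := congrFun ha (i + n)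
      rw [telescope_apply, Pi.zero_apply, sub_eq_zero] at this
      rw [this, add_right_comm]
    simpa using this
  · intro c
    refine ⟨fun n => C.sum fun i => c (i + n), ?_⟩
    ext n
    rw [telescope_apply, C.sum_eq fun i => c (i + n)]
    simp only [zero_add, add_assoc, add_comm 1 n, add_sub_cancel_right]

theorem sum_eq_telescopeSum (C : SummationSpace k) (c : ℕ → C.carrier) :
    C.sum c = telescopeSum C.bijective_telescope_shift c := by
  have := telescopeSum_unique C.bijective_telescope_shift (c := c)
    (a := fun n => C.sum fun i => c (i + n)) fun n => by
      rw [C.sum_eq fun i => c (i + n)]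
      simp only [zero_add, add_assoc, add_comm 1 n]
  simpa using this

/-- The space with infinite summation defined by an operator with bijective `telescope`. -/
noncomputable def ofTelescope (A : ModuleCat.{u} k) {z : A →ₗ[k] A}
    (hz : Function.Bijective (telescope z)) : SummationSpace k where
  carrier := A
  sum := telescopeSum hz
  sum_unital c hc := by
    rw [telescopeSum_eq, show (fun n => c (n + 1)) = 0 from funext fun n => hc _ (by omega)]
    simp
  sum_assoc c := by
    symm
    -- The sums of the diagonal series of the rows from `n` on satisfy the recursion whose inputs
    -- are the row sums, so uniqueness identifies the two sides.
    have := telescopeSum_unique hz (c := fun i => telescopeSum hz (c i))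
      (a := fun n => telescopeSum hz (diagonalSum fun i => c (i + n))) fun n => by
        rw [diagonalSum_eq (k := k), map_add, telescopeSum_eq hz (rightShift _)]
        simp only [zero_add, add_assoc, add_comm 1 n, rightShift_zero, rightShift_succ]
    simp only [add_zero] at this
    exact this

theorem shift_ofTelescope (A : ModuleCat.{u} k) {z : A →ₗ[k] A}
    (hz : Function.Bijective (telescope z)) : (ofTelescope A hz).shift = z :=
  LinearMap.ext (telescopeSum_single_one hz)

theorem Hom.comm {C D : SummationSpace k} (φ : Hom C D) (v : C.carrier) :
    φ.toLin (C.shift v) = D.shift (φ.toLin v) := by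
  rw [shift_apply, φ.map_sum, shift_apply]
  congr 1
  ext n
  exact Pi.apply_single (fun _ => φ.toLin) (fun _ => map_zero _) 1 v n

/-- A linear map commuting with the operators preserves infinite sums. -/
def Hom.ofComm {C D : SummationSpace k} (φ : C.carrier →ₗ[k] D.carrier)
    (hφ : ∀ v, φ (C.shift v) = D.shift (φ v)) : Hom C D where
  toLin := φ
  map_sum c := by
    -- The images under `φ` of the tail sums of `c` satisfy the recursion that determines the sum in
    -- `D`.
    have := telescopeSum_unique D.bijective_telescope_shift (c := fun n => φ (c n))
      (a := fun n => φ (C.sum fun i => c (i + n))) fun n => by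
        rw [C.sum_eq fun i => c (i + n), map_add, hφ]
        simp only [zero_add, add_assoc, add_comm 1 n]
    rw [sum_eq_telescopeSum D, ← this]
    simp

/-- The `{p}`-contramodule given by an infinite summation operation. -/
def toContramodule (p : OnePoint k) :
    SummationSpace k ⥤ (IsContramodule ({p} : Set (OnePoint k))).FullSubcategory where
  obj C := ⟨ofMaps p C.shift LinearMap.id,
    (isSummableAt_ofMaps p C.bijective_telescope_shift).isContramodule⟩
  map φ := ObjectProperty.homMk (ofMapsMap p φ.toLin φ.comm)
  map_id V := ObjectProperty.hom_ext _ (ofMapsMap_id (z := V.shift) p fun _ => rfl)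
  map_comp φ ψ := ObjectProperty.hom_ext _
    (ofMapsMap_comp p φ.toLin φ.comm ψ.toLin ψ.comm (φ ≫ ψ).comm)

instance (p : OnePoint k) : (toContramodule p).Faithful where
  map_injective {_ _} φ ψ h :=
    Hom.ext (ofMapsMap_injective φ.comm ψ.comm (congrArg InducedCategory.Hom.hom h))

instance (p : OnePoint k) : (toContramodule p).Full where
  map_surjective h := by
    obtain ⟨φ, hφ, hh⟩ := ofMapsMap_surjective h.hom
    exact ⟨Hom.ofComm φ hφ, ObjectProperty.hom_ext _ hh⟩

instance (p : OnePoint k) : (toContramodule p).EssSurj where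
  mem_essImage C := by
    obtain ⟨hw, z, hz, hn⟩ := isContramodule_singleton_iff.1 C.property
    obtain ⟨e⟩ := nonempty_iso_ofMaps (z := (ofTelescope (C.obj.obj .one) hn).shift) hw (fun x => by
      rw [shift_ofTelescope]
      exact hz x)
    exact ⟨ofTelescope _ hn, ⟨ObjectProperty.isoMk _ e⟩⟩

instance (p : OnePoint k) : (toContramodule p).IsEquivalence where

end SummationSpace

end KroneckerQuiver

theorem mainTheorem8 {k : Type u} [Field k] [IsAlgClosed k]
    (X : Set (OnePoint k)) (hX : OnePoint.infty ∈ X) :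
    -- (a) comodules
    ((∀ M : QuiverRep k, IsComodule X M ↔ Nonempty (SumDecomposition X M)) ∧
      -- functoriality of the decomposition
      (∀ (M N : QuiverRep k) (D : SumDecomposition X M) (E : SumDecomposition X N) (φ : M ⟶ N),
        ∃! ψ : ∀ p : X, D.component p ⟶ E.component p,
          ∀ p, D.incl p ≫ φ = ψ p ≫ E.incl p) ∧
      -- uniqueness of the decomposition
      (∀ (M : QuiverRep k) (D E : SumDecomposition X M),
        ∃! ψ : ∀ p : X, D.component p ≅ E.component p,
          ∀ p, (ψ p).hom ≫ E.incl p = D.incl p) ∧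
      -- the direct sum functor is an equivalence onto the category of `X`-comodules
      (∃ e : (∀ p : X, (IsComodule ({p.1} : Set (OnePoint k))).FullSubcategory) ≌
          (IsComodule X).FullSubcategory,
        Nonempty (e.functor ⋙ (IsComodule X).ι ≅ sumFunctor X)) ∧
      (∀ p ∈ X, Nonempty ((IsComodule ({p} : Set (OnePoint k))).FullSubcategory ≌
        NilpotentSpace k))) ∧
    -- (b) contramodules
    ((∀ C : QuiverRep k, IsContramodule X C ↔ Nonempty (ProdDecomposition X C)) ∧
      -- functoriality of the decomposition
      (∀ (C B : QuiverRep k) (D : ProdDecomposition X C) (E : ProdDecomposition X B) (φ : C ⟶ B),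
        ∃! ψ : ∀ p : X, D.component p ⟶ E.component p,
          ∀ p, φ ≫ E.proj p = D.proj p ≫ ψ p) ∧
      -- uniqueness of the decomposition
      (∀ (C : QuiverRep k) (D E : ProdDecomposition X C),
        ∃! ψ : ∀ p : X, D.component p ≅ E.component p,
          ∀ p, D.proj p ≫ (ψ p).hom = E.proj p) ∧
      -- the direct product functor is an equivalence onto the category of `X`-contramodules
      (∃ e : (∀ p : X, (IsContramodule ({p.1} : Set (OnePoint k))).FullSubcategory) ≌
          (IsContramodule X).FullSubcategory,
        Nonempty (e.functor ⋙ (IsContramodule X).ι ≅ prodFunctor X)) ∧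
      (∀ p ∈ X, Nonempty ((IsContramodule ({p} : Set (OnePoint k))).FullSubcategory ≌
        SummationSpace k))) := by
  refine ⟨⟨fun M => ⟨IsComodule.nonempty_sumDecomposition, fun ⟨D⟩ => D.isComodule_total⟩,
    fun M N D E φ => D.existsUnique_hom E φ, fun M D E => D.existsUnique_iso E,
    ⟨(sumLift X).asEquivalence, ⟨Iso.refl _⟩⟩,
    fun p _ => ⟨(NilpotentSpace.toComodule p).asEquivalence.symm⟩⟩,
    ⟨fun C => ⟨IsContramodule.nonempty_prodDecomposition, fun ⟨D⟩ => D.isContramodule_total⟩,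
    fun C B D E φ => D.existsUnique_hom E φ, fun C D E => D.existsUnique_iso E,
    ⟨(prodLift X).asEquivalence, ⟨Iso.refl _⟩⟩,
    fun p _ => ⟨(SummationSpace.toContramodule p).asEquivalence.symm⟩⟩⟩
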